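/- Let $E=(E_{abc})_{a,b,c=1}^{3}$ be an array of complex numbers with $E_{abc}\neq 0$ if and only if $(a,b,c)$ is a permutation of $\{1,2,3\}$. Let $\mathbb G=(\mathsf A,u)$ be the compact quantum group related to $E$ by the Woronowicz construction (a PW-quantum group of dimension $3$): $\mathsf A$ is the universal unital C$^*$-algebra generated by the entries of $u=[u_{jk}]_{j,k=1}^3$ subject to $$\sum_{s}u_{js}u_{ks}^*=\delta_{jk}1=\sum_{s}u_{sj}^*u_{sk},\qquad \sum_{i_1,i_2,i_3}E_{i_1i_2i_3}\,u_{a_1i_1}u_{a_2i_2}u_{a_3i_3}=E_{a_1a_2a_3}1 ,$$ with comultiplication $\Delta(u_{jk})=\sum_s u_{js}\otimes u_{sk}$ into the minimal C$^*$-tensor product. For $q=|q|e^{\mathrm i t}\in\mathbb C^*$ let $U_q(2)$ be the universal unital C$^*$-algebra generated by $a,c,v$ with $$ac=\bar q\,ca,\quad ac^*=q\,c^*a,\quad a^*a+c^*c=1,\quad aa^*+|q|^2c^*c=1,\quad cc^*=c^*c,$$ $$vv^*=v^*v=1,\quad av=va,\quad cv=e^{-2\mathrm i t}vc,$$ with the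 comultiplication determined by the fundamental corepresentation $$\begin{pmatrix} v&0&0\\ 0&a&-q\,c^*v^*\\ 0&c&a^*v^*\end{pmatrix},$$ and let $C(\mathbb T^2)$ carry the comultiplication determined by the fundamental corepresentation $\mathrm{diag}(z_1,z_2)$. Isomorphism ($\cong$) means a $*$-isomorphism of the C$^*$-algebras that intertwines the comultiplications. Suppose that $u$ decomposes into a $1\times1$ block with index $k$ and a $2\times 2$ block, i.e. $u_{kj}=u_{jk}=0$ for all $j\neq k$ (the $2\times2$ block may decompose further). Let $r,i$ be the two remaining indices, in either order. Then: 1. $\mathbb G\cong C(\mathbb T^2)$, or $\mathbb G\cong U_q(2)$ for some $q\in\mathbb C^*$. 2. $\mathbb G\cong U_q(2)$ for some $q\in\mathbb C^*$ if and only if $$\frac{E_{kri}}{E_{kir}}=\frac{E_{rik}}{E_{irk}}\qquad\text{and}\qquad \frac{E_{kri}}{E_{kir}}=\frac{\overline{E_{rki}}}{\overline{E_{ikr}}}.$$ 3. If these two conditions hold, then $q=-\dfrac{E_{kri}}{E_{kir}}$ lies in $\mathbb C^*$ and $\mathbb G\cong U_q(2)$ for this $q$. -/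

import Mathlib

open scoped TensorProduct InnerProductSpace

noncomputable section

/-! ### C⋆-seminorms and the C⋆-algebras they generate -/

/-- A C⋆-seminorm on a unital complex ⋆-algebra `F`. -/
structure CStarSeminorm (F : Type) [Ring F] [StarRing F] [Algebra ℂ F] [StarModule ℂ F]
    extends Seminorm ℂ F where
  mul_le' : ∀ x y, toFun (x * y) ≤ toFun x * toFun y
  star_mul_self' : ∀ x, toFun (star x * x) = toFun x ^ 2

namespace CStarSeminorm

variable {F : Type} [Ring F] [StarRing F] [Algebra ℂ F] [StarModule ℂ F]

theorem le_star (p : CStarSeminorm F) (x : F) : p.toSeminorm x ≤ p.toSeminorm (star x) := by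
  have h1 : p.toSeminorm (star x * x) = p.toSeminorm x ^ 2 := p.star_mul_self' x
  have h2 : p.toSeminorm (star x * x) ≤ p.toSeminorm (star x) * p.toSeminorm x :=
    p.mul_le' (star x) x
  have h3 : 0 ≤ p.toSeminorm x := apply_nonneg _ _
  have h4 : 0 ≤ p.toSeminorm (star x) := apply_nonneg _ _
  by_contra h
  push Not at h
  nlinarith

theorem star_eq (p : CStarSeminorm F) (x : F) : p.toSeminorm (star x) = p.toSeminorm x :=
  le_antisymm (by simpa using p.le_star (star x)) (p.le_star x)

/-- The pointwise supremum of a pointwise bounded set of C⋆-seminorms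
(the zero seminorm if the set is empty). -/
def sup (S : Set (CStarSeminorm F))
    (hS : ∀ x, ∃ C : ℝ, ∀ p ∈ S, p.toSeminorm x ≤ C) : CStarSeminorm F := by
  have hb : ∀ x, BddAbove (Set.range fun p : S => p.1.toSeminorm x) := by
    intro x
    obtain ⟨C, hC⟩ := hS x
    refine ⟨C, ?_⟩
    rintro _ ⟨p, rfl⟩
    exact hC p.1 p.2
  have h0 : ∀ x, 0 ≤ ⨆ p : S, p.1.toSeminorm x :=
    fun x => Real.iSup_nonneg fun p => apply_nonneg _ _
  have hle : ∀ x (p : S), p.1.toSeminorm x ≤ ⨆ p : S, p.1.toSeminorm x :=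
    fun x p => le_ciSup (hb x) p
  exact
  { Seminorm.of (fun x => ⨆ p : S, p.1.toSeminorm x)
      (fun x y => Real.iSup_le (fun p => (map_add_le_add _ x y).trans
        (add_le_add (hle x p) (hle y p))) (add_nonneg (h0 x) (h0 y)))
      (fun a x => by
        simp only [map_smul_eq_mul]
        rw [Real.mul_iSup_of_nonneg (norm_nonneg a)]) with
    mul_le' := fun x y => Real.iSup_le (fun p => (p.1.mul_le' x y).trans
        (mul_le_mul (hle x p) (hle y p) (apply_nonneg p.1.toSeminorm y) (h0 x))) (mul_nonneg (h0 x) (h0 y))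
    star_mul_self' := fun x => by
      have h : ∀ p : S, p.1.toSeminorm (star x * x) = p.1.toSeminorm x ^ 2 :=
        fun p => p.1.star_mul_self' x
      change (⨆ p : S, p.1.toSeminorm (star x * x)) = (⨆ p : S, p.1.toSeminorm x) ^ 2
      simp only [h]
      exact (Real.iSup_pow_of_ne_zero (fun p => apply_nonneg _ _) two_ne_zero).symm }

theorem le_sup (S : Set (CStarSeminorm F))
    (hS : ∀ x, ∃ C : ℝ, ∀ p ∈ S, p.toSeminorm x ≤ C) (p : CStarSeminorm F) (hp : p ∈ S) (x : F) :
    p.toSeminorm x ≤ (sup S hS).toSeminorm x := by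
  obtain ⟨C, hC⟩ := hS x
  exact le_ciSup (f := fun p : S => p.1.toSeminorm x)
    ⟨C, by rintro _ ⟨p, rfl⟩; exact hC p.1 p.2⟩ ⟨p, hp⟩

/-- The ⋆-algebra `F`, regarded as a seminormed space through `p`. -/
def Dom (_p : CStarSeminorm F) : Type := F

variable (p : CStarSeminorm F)

instance : Ring p.Dom := inferInstanceAs (Ring F)
instance : StarRing p.Dom := inferInstanceAs (StarRing F)
instance : Algebra ℂ p.Dom := inferInstanceAs (Algebra ℂ F)
instance : StarModule ℂ p.Dom := inferInstanceAs (StarModule ℂ F)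

instance : SeminormedRing p.Dom :=
  { (inferInstance : Ring p.Dom),
    p.toSeminorm.toAddGroupSeminorm.toSeminormedAddGroup with
    norm_mul_le := p.mul_le' }

theorem norm_dom (x : p.Dom) : ‖x‖ = p.toSeminorm x := rfl

instance : NormedAlgebra ℂ p.Dom where
  norm_smul_le a x := (map_smul_eq_mul p.toSeminorm a x).le

theorem isometry_star_dom : Isometry (star : p.Dom → p.Dom) :=
  AddMonoidHomClass.isometry_of_norm (starAddEquiv : p.Dom ≃+ p.Dom) fun x => p.star_eq x

/-- The C⋆-algebra obtained from `F` by dividing out the kernel of `p` and completing. -/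
def Completion : Type := UniformSpace.Completion p.Dom

instance : NormedRing p.Completion := inferInstanceAs (NormedRing (UniformSpace.Completion p.Dom))
instance : CompleteSpace p.Completion :=
  inferInstanceAs (CompleteSpace (UniformSpace.Completion p.Dom))

instance : NormedAlgebra ℂ p.Completion :=
  { (inferInstance : Algebra ℂ (UniformSpace.Completion p.Dom)) with
    norm_smul_le := fun a x => norm_smul_le (α := ℂ) (β := UniformSpace.Completion p.Dom) a x }

/-- The canonical map from `F` into the completion. -/
def ofFun (x : F) : p.Completion := UniformSpace.Completion.coe' (show p.Dom from x)

@[elab_as_elim]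
theorem induction {P : p.Completion → Prop} (x : p.Completion) (hc : IsClosed {x | P x})
    (h : ∀ x : F, P (p.ofFun x)) : P x :=
  UniformSpace.Completion.induction_on x hc h

theorem norm_ofFun (x : F) : ‖p.ofFun x‖ = p.toSeminorm x :=
  UniformSpace.Completion.norm_coe (E := p.Dom) x

theorem ofFun_add (x y : F) : p.ofFun (x + y) = p.ofFun x + p.ofFun y :=
  UniformSpace.Completion.coe_add (α := p.Dom) x y

theorem ofFun_mul (x y : F) : p.ofFun (x * y) = p.ofFun x * p.ofFun y :=
  UniformSpace.Completion.coe_mul (α := p.Dom) x y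

theorem ofFun_smul (a : ℂ) (x : F) : p.ofFun (a • x) = a • p.ofFun x :=
  UniformSpace.Completion.coe_smul (X := p.Dom) a x

instance : Star p.Completion := ⟨UniformSpace.Completion.map (star : p.Dom → p.Dom)⟩

theorem ofFun_star (x : F) : p.ofFun (star x) = star (p.ofFun x) :=
  (UniformSpace.Completion.map_coe p.isometry_star_dom.uniformContinuous (x : p.Dom)).symm

theorem continuous_star_completion : Continuous (star : p.Completion → p.Completion) :=
  UniformSpace.Completion.continuous_map (f := (star : p.Dom → p.Dom))

instance : StarRing p.Completion where
  star_involutive x := by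
    refine p.induction x (isClosed_eq (p.continuous_star_completion.comp
      p.continuous_star_completion) continuous_id) fun x => ?_
    rw [← ofFun_star, ← ofFun_star, star_star]
  star_mul x y := by
    have hs := p.continuous_star_completion
    refine p.induction x (isClosed_eq (hs.comp (continuous_id.mul continuous_const))
      (continuous_const.mul hs)) fun x => ?_
    refine p.induction y (isClosed_eq (hs.comp (continuous_const.mul continuous_id))
      (hs.mul continuous_const)) fun y => ?_
    simp only [← ofFun_star, ← ofFun_mul, star_mul]
  star_add x y := by
    have hs := p.continuous_star_completion
    refine p.induction x (isClosed_eq (hs.comp (continuous_id.add continuous_const))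
      (hs.add continuous_const)) fun x => ?_
    refine p.induction y (isClosed_eq (hs.comp (continuous_const.add continuous_id))
      (continuous_const.add hs)) fun y => ?_
    simp only [← ofFun_star, ← ofFun_add, star_add]

instance : StarModule ℂ p.Completion where
  star_smul a x := by
    have hs := p.continuous_star_completion
    refine p.induction x (isClosed_eq (hs.comp (continuous_const_smul a))
      (hs.const_smul (star a))) fun x => ?_
    simp only [← ofFun_star, ← ofFun_smul, star_smul]

instance : CStarRing p.Completion where
  norm_mul_self_le x := by
    have hs := p.continuous_star_completion
    refine p.induction x (isClosed_le (continuous_norm.mul continuous_norm)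
      (continuous_norm.comp (hs.mul continuous_id))) fun x => ?_
    rw [← ofFun_star, ← ofFun_mul, norm_ofFun, norm_ofFun, ← pow_two]
    exact (p.star_mul_self' x).ge

instance : CStarAlgebra p.Completion where

/-- The canonical ⋆-homomorphism from `F` into the completion. -/
def of : F →⋆ₐ[ℂ] p.Completion where
  toFun := p.ofFun
  map_one' := rfl
  map_mul' := p.ofFun_mul
  map_zero' := rfl
  map_add' := p.ofFun_add
  commutes' _ := rfl
  map_star' := p.ofFun_star

theorem norm_of (x : F) : ‖p.of x‖ = p.toSeminorm x := p.norm_ofFun x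

/-- The seminorm `x ↦ ‖φ x‖` induced by a ⋆-homomorphism into a C⋆-algebra. -/
def ofHom {B : Type*} [CStarAlgebra B] (φ : F →⋆ₐ[ℂ] B) : CStarSeminorm F :=
  { (normSeminorm ℂ B).comp (φ : F →ₗ[ℂ] B) with
    mul_le' := fun x y => by
      change ‖φ (x * y)‖ ≤ ‖φ x‖ * ‖φ y‖
      rw [map_mul]
      exact norm_mul_le _ _
    star_mul_self' := fun x => by
      change ‖φ (star x * x)‖ = ‖φ x‖ ^ 2
      rw [map_mul, map_star, CStarRing.norm_star_mul_self, pow_two] }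

theorem ofHom_apply {B : Type*} [CStarAlgebra B] (φ : F →⋆ₐ[ℂ] B) (x : F) :
    (ofHom φ).toSeminorm x = ‖φ x‖ := rfl

variable {F' : Type} [Ring F'] [StarRing F'] [Algebra ℂ F'] [StarModule ℂ F']

/-- A ⋆-homomorphism, regarded as a ring homomorphism of seminormed rings. -/
def domHom (p : CStarSeminorm F) (p' : CStarSeminorm F') (f : F →⋆ₐ[ℂ] F') : p.Dom →+* p'.Dom :=
  (f : F →+* F')

/-- A ⋆-homomorphism that does not increase the seminorms extends to the completions. -/
def map {p : CStarSeminorm F} {p' : CStarSeminorm F'} (f : F →⋆ₐ[ℂ] F')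
    (hf : ∀ x, p'.toSeminorm (f x) ≤ p.toSeminorm x) : p.Completion →⋆ₐ[ℂ] p'.Completion := by
  have hcont : Continuous (domHom p p' f) :=
    AddMonoidHomClass.continuous_of_bound (domHom p p' f) 1
      fun x => (hf x).trans_eq (one_mul _).symm
  let g : p.Completion →+* p'.Completion :=
    UniformSpace.Completion.mapRingHom (domHom p p' f) hcont
  have hg : ∀ x : F, g (p.ofFun x) = p'.ofFun (f x) :=
    fun x => UniformSpace.Completion.mapRingHom_coe hcont (x : p.Dom)
  have hgc : Continuous g :=
    UniformSpace.Completion.continuous_map (f := domHom p p' f)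
  exact
  { toFun := g
    map_one' := map_one g
    map_mul' := map_mul g
    map_zero' := map_zero g
    map_add' := map_add g
    commutes' := fun a => (hg (algebraMap ℂ F a)).trans
      (congrArg p'.ofFun (AlgHomClass.commutes f a))
    map_star' := fun x => by
      refine p.induction x (isClosed_eq (hgc.comp p.continuous_star_completion)
        (p'.continuous_star_completion.comp hgc)) fun x => ?_
      rw [← ofFun_star, hg, hg, map_star, ofFun_star] }

theorem map_of {p : CStarSeminorm F} {p' : CStarSeminorm F'} (f : F →⋆ₐ[ℂ] F')
    (hf : ∀ x, p'.toSeminorm (f x) ≤ p.toSeminorm x) (x : F) :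
    map f hf (p.of x) = p'.of (f x) :=
  UniformSpace.Completion.map_coe
    (uniformContinuous_addMonoidHom_of_continuous
      (AddMonoidHomClass.continuous_of_bound (domHom p p' f) 1
        fun x => (hf x).trans_eq (one_mul _).symm)) (x : p.Dom)

/-- A ⋆-homomorphism into a C⋆-algebra that is bounded by `p` extends to the completion. -/
theorem exists_extension {p : CStarSeminorm F} {B : Type*} [CStarAlgebra B] (φ : F →⋆ₐ[ℂ] B)
    (hφ : ∀ x, ‖φ x‖ ≤ p.toSeminorm x) :
    ∃ ψ : p.Completion →⋆ₐ[ℂ] B, ∀ x, ψ (p.of x) = φ x := by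
  let f : p.Dom →+* B := (φ : F →+* B)
  have hcont : Continuous f :=
    AddMonoidHomClass.continuous_of_bound f 1 fun x => (hφ x).trans_eq (one_mul _).symm
  let g : p.Completion →+* B := UniformSpace.Completion.extensionHom f hcont
  have hg : ∀ x : F, g (p.ofFun x) = φ x :=
    fun x => UniformSpace.Completion.extensionHom_coe f hcont (x : p.Dom)
  have hgc : Continuous g := UniformSpace.Completion.continuous_extension (f := f)
  exact ⟨{ toFun := g
           map_one' := map_one g
           map_mul' := map_mul g
           map_zero' := map_zero g
           map_add' := map_add g
           commutes' := fun a => (hg (algebraMap ℂ F a)).trans (AlgHomClass.commutes φ a)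
           map_star' := fun x => by
             refine p.induction x (isClosed_eq (hgc.comp p.continuous_star_completion)
               (continuous_star.comp hgc)) fun x => ?_
             rw [← ofFun_star, hg, hg, map_star] }, hg⟩

end CStarSeminorm

/-! ### Universal C⋆-algebras given by generators and relations -/

/-- The free unital complex ⋆-algebra on a type `X` of generators: noncommutative polynomials in
the letters `inl x` (the generators) and `inr x` (their adjoints). -/
def FreeStarAlgebra (X : Type) : Type := FreeAlgebra ℂ (X ⊕ X)

namespace FreeStarAlgebra

variable {X : Type}

instance : Ring (FreeStarAlgebra X) := inferInstanceAs (Ring (FreeAlgebra ℂ (X ⊕ X)))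
instance : Algebra ℂ (FreeStarAlgebra X) := inferInstanceAs (Algebra ℂ (FreeAlgebra ℂ (X ⊕ X)))

/-- A letter of the free ⋆-algebra. -/
def letter (x : X ⊕ X) : FreeStarAlgebra X := FreeAlgebra.ι ℂ x

/-- A generator of the free ⋆-algebra. -/
def gen (x : X) : FreeStarAlgebra X := letter (Sum.inl x)

@[elab_as_elim]
theorem induction {P : FreeStarAlgebra X → Prop} (h1 : ∀ c : ℂ, P (algebraMap ℂ _ c))
    (h2 : ∀ x, P (letter x)) (h3 : ∀ x y, P x → P y → P (x * y))
    (h4 : ∀ x y, P x → P y → P (x + y)) (x : FreeStarAlgebra X) : P x :=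
  FreeAlgebra.induction ℂ (X ⊕ X) (motive := P) h1 h2 h3 h4 x

/-- The conjugate-linear antimultiplicative map that interchanges `inl x` and `inr x`. -/
def starAux (X : Type) : FreeStarAlgebra X →+* (FreeStarAlgebra X)ᵐᵒᵖ :=
  letI : Algebra ℂ (FreeStarAlgebra X)ᵐᵒᵖ := Algebra.compHom _ (starRingEnd ℂ)
  ((FreeAlgebra.lift ℂ fun x : X ⊕ X => MulOpposite.op (letter x.swap) :
    FreeAlgebra ℂ (X ⊕ X) →ₐ[ℂ] (FreeStarAlgebra X)ᵐᵒᵖ) :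
      FreeAlgebra ℂ (X ⊕ X) →+* (FreeStarAlgebra X)ᵐᵒᵖ)

theorem starAux_letter (x : X ⊕ X) : starAux X (letter x) = MulOpposite.op (letter x.swap) :=
  letI : Algebra ℂ (FreeStarAlgebra X)ᵐᵒᵖ := Algebra.compHom _ (starRingEnd ℂ)
  FreeAlgebra.lift_ι_apply (R := ℂ) (fun x : X ⊕ X => MulOpposite.op (letter x.swap)) x

theorem starAux_algebraMap (c : ℂ) : starAux X (algebraMap ℂ _ c) =
    MulOpposite.op (algebraMap ℂ (FreeStarAlgebra X) (star c)) :=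
  letI : Algebra ℂ (FreeStarAlgebra X)ᵐᵒᵖ := Algebra.compHom _ (starRingEnd ℂ)
  (FreeAlgebra.lift ℂ fun x : X ⊕ X => MulOpposite.op (letter x.swap) :
    FreeAlgebra ℂ (X ⊕ X) →ₐ[ℂ] (FreeStarAlgebra X)ᵐᵒᵖ).commutes c

instance : StarRing (FreeStarAlgebra X) where
  star x := (starAux X x).unop
  star_involutive x := by
    change (starAux X (starAux X x).unop).unop = x
    induction x using induction with
    | h1 c => simp [starAux_algebraMap]
    | h2 x => simp [starAux_letter]
    | h3 x y hx hy => simp [hx, hy]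
    | h4 x y hx hy => simp [hx, hy]
  star_mul x y := by
    change (starAux X (x * y)).unop = _
    rw [map_mul]
    rfl
  star_add x y := by
    change (starAux X (x + y)).unop = _
    rw [map_add]
    rfl

theorem star_letter (x : X ⊕ X) : star (letter x) = letter x.swap :=
  congrArg MulOpposite.unop (starAux_letter x)

theorem star_algebraMap (c : ℂ) :
    star (algebraMap ℂ (FreeStarAlgebra X) c) = algebraMap ℂ _ (star c) :=
  congrArg MulOpposite.unop (starAux_algebraMap c)

instance : StarModule ℂ (FreeStarAlgebra X) where
  star_smul c x := by
    rw [Algebra.smul_def, star_mul, star_algebraMap, Algebra.smul_def, Algebra.commutes]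

/-- Evaluation of noncommutative ⋆-polynomials at a family of elements of a ⋆-algebra. -/
def eval {B : Type*} [Ring B] [StarRing B] [Algebra ℂ B] [StarModule ℂ B] (w : X → B) :
    FreeStarAlgebra X →⋆ₐ[ℂ] B :=
  let f : FreeStarAlgebra X →ₐ[ℂ] B :=
    (FreeAlgebra.lift ℂ (Sum.elim w fun x => star (w x)) : FreeAlgebra ℂ (X ⊕ X) →ₐ[ℂ] B)
  have hf : ∀ x, f (letter x) = Sum.elim w (fun x => star (w x)) x := fun x =>
    FreeAlgebra.lift_ι_apply _ x
  { f with
    map_star' := fun x => by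
      change f (star x) = star (f x)
      induction x using induction with
      | h1 c => rw [star_algebraMap, AlgHom.commutes, AlgHom.commutes, algebraMap_star_comm]
      | h2 x => rw [star_letter, hf, hf]; cases x <;> simp
      | h3 x y hx hy => rw [star_mul, map_mul, map_mul, star_mul, hx, hy]
      | h4 x y hx hy => rw [star_add, map_add, map_add, star_add, hx, hy] }

theorem eval_gen {B : Type*} [Ring B] [StarRing B] [Algebra ℂ B] [StarModule ℂ B] (w : X → B)
    (x : X) : eval w (gen x) = w x :=
  FreeAlgebra.lift_ι_apply (R := ℂ) (Sum.elim w fun x => star (w x)) (Sum.inl x)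

end FreeStarAlgebra

open FreeStarAlgebra in
/-- The largest C⋆-seminorm on the free ⋆-algebra on `X` that vanishes on the relators `R` and is
at most one on the generators. (For every set of relators used below, the relations themselves
force the generators to have norm at most one.) -/
def universalSeminorm {X : Type} (R : Set (FreeStarAlgebra X)) :
    CStarSeminorm (FreeStarAlgebra X) :=
  CStarSeminorm.sup
    {p | (∀ r ∈ R, p.toSeminorm r = 0) ∧ ∀ x, p.toSeminorm (gen x) ≤ 1} (by
      intro x
      induction x using FreeStarAlgebra.induction with
      | h1 c =>
        refine ⟨‖c‖, fun p _ => ?_⟩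
        have h : p.toSeminorm (1 : FreeStarAlgebra X) = p.toSeminorm 1 ^ 2 := by
          have h := p.star_mul_self' 1
          rwa [star_one, mul_one] at h
        have h1 : p.toSeminorm (1 : FreeStarAlgebra X) ≤ 1 := by nlinarith
        rw [Algebra.algebraMap_eq_smul_one, map_smul_eq_mul]
        exact mul_le_of_le_one_right (norm_nonneg c) h1
      | h2 x =>
        refine ⟨1, fun p hp => ?_⟩
        cases x with
        | inl x => exact hp.2 x
        | inr x =>
          rw [← p.star_eq, star_letter]
          exact hp.2 x
      | h3 x y hx hy =>
        obtain ⟨C, hC⟩ := hx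
        obtain ⟨D, hD⟩ := hy
        exact ⟨C * D, fun p hp => (p.mul_le' x y).trans
          (mul_le_mul (hC p hp) (hD p hp) (apply_nonneg p.toSeminorm y)
            ((apply_nonneg p.toSeminorm x).trans (hC p hp)))⟩
      | h4 x y hx hy =>
        obtain ⟨C, hC⟩ := hx
        obtain ⟨D, hD⟩ := hy
        exact ⟨C + D, fun p hp => (map_add_le_add p.toSeminorm x y).trans
          (add_le_add (hC p hp) (hD p hp))⟩)

theorem le_universalSeminorm {X : Type} {R : Set (FreeStarAlgebra X)}
    (p : CStarSeminorm (FreeStarAlgebra X)) (hR : ∀ r ∈ R, p.toSeminorm r = 0)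
    (h1 : ∀ x, p.toSeminorm (FreeStarAlgebra.gen x) ≤ 1) (x : FreeStarAlgebra X) :
    p.toSeminorm x ≤ (universalSeminorm R).toSeminorm x :=
  CStarSeminorm.le_sup _ _ p (And.intro hR h1) x

/-- The universal unital C⋆-algebra generated by `X` subject to the relations `r = 0`, `r ∈ R`. -/
abbrev UniversalCStar {X : Type} (R : Set (FreeStarAlgebra X)) : Type :=
  (universalSeminorm R).Completion

/-- The generators of the universal C⋆-algebra. -/
def UniversalCStar.gen {X : Type} (R : Set (FreeStarAlgebra X)) (x : X) : UniversalCStar R :=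
  (universalSeminorm R).of (FreeStarAlgebra.gen x)

/-- The relations hold in the universal C⋆-algebra. -/
theorem UniversalCStar.of_eq_zero {X : Type} {R : Set (FreeStarAlgebra X)}
    {r : FreeStarAlgebra X} (hr : r ∈ R) : (universalSeminorm R).of r = 0 := by
  rw [← norm_eq_zero, CStarSeminorm.norm_of]
  refine le_antisymm (Real.iSup_le (fun p => (p.2.1 r hr).le) le_rfl) (apply_nonneg _ _)

/-- The universal property: a family of contractions in a C⋆-algebra that satisfies the relations
is the image of the generators under a unital ⋆-homomorphism. -/
theorem UniversalCStar.exists_hom {X : Type} {R : Set (FreeStarAlgebra X)} {B : Type*}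
    [CStarAlgebra B] (w : X → B) (hw : ∀ r ∈ R, FreeStarAlgebra.eval w r = 0)
    (h1 : ∀ x, ‖w x‖ ≤ 1) :
    ∃ φ : UniversalCStar R →⋆ₐ[ℂ] B, ∀ x, φ (UniversalCStar.gen R x) = w x := by
  have hle : ∀ x, ‖FreeStarAlgebra.eval w x‖ ≤ (universalSeminorm R).toSeminorm x := fun x =>
    le_universalSeminorm (CStarSeminorm.ofHom (FreeStarAlgebra.eval w))
      (fun r hr => by rw [CStarSeminorm.ofHom_apply, hw r hr, norm_zero])
      (fun x => by rw [CStarSeminorm.ofHom_apply, FreeStarAlgebra.eval_gen]; exact h1 x) x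
  obtain ⟨φ, hφ⟩ := CStarSeminorm.exists_extension (FreeStarAlgebra.eval w) hle
  exact ⟨φ, fun x => (hφ _).trans (FreeStarAlgebra.eval_gen w x)⟩

/-- If `∑ s, (x s)⋆ * x s = 1` in a C⋆-algebra, then every `x s` is a contraction. -/
theorem norm_le_one_of_sum_star_mul_self {ι B : Type*} [Fintype ι] [CStarAlgebra B] (x : ι → B)
    (h : ∑ s, star (x s) * x s = 1) (s : ι) : ‖x s‖ ≤ 1 := by
  let _ := CStarAlgebra.spectralOrder B
  have _ := CStarAlgebra.spectralOrderedRing B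
  have h1 : star (x s) * x s ≤ 1 := h ▸ Finset.single_le_sum
    (f := fun s => star (x s) * x s) (fun t _ => star_mul_self_nonneg (x t)) (Finset.mem_univ s)
  have h2 := (CStarAlgebra.norm_le_one_iff_of_nonneg _ (star_mul_self_nonneg (x s))).2 h1
  rw [CStarRing.norm_star_mul_self] at h2
  nlinarith [norm_nonneg (x s)]

/-! ### The minimal tensor product of C⋆-algebras -/

section MinTensor

variable {A B H K : Type} [CStarAlgebra A] [CStarAlgebra B]
  [NormedAddCommGroup H] [InnerProductSpace ℂ H] [CompleteSpace H]
  [NormedAddCommGroup K] [InnerProductSpace ℂ K] [CompleteSpace K]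

/-- The representation `a ⊗ b ↦ π a ⊗ ρ b` of the algebraic tensor product by bounded operators on
the algebraic tensor product of the two Hilbert spaces (with its Hilbert space norm). -/
def tensorRep (π : A →⋆ₐ[ℂ] (H →L[ℂ] H)) (ρ : B →⋆ₐ[ℂ] (K →L[ℂ] K)) :
    A ⊗[ℂ] B →ₐ[ℂ] ((H ⊗[ℂ] K) →L[ℂ] (H ⊗[ℂ] K)) :=
  Algebra.TensorProduct.lift
    (AlgHom.ofLinearMap
      { toFun := fun a => (π a).rTensor K
        map_add' := fun a b => by rw [map_add, ContinuousLinearMap.rTensor_add]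
        map_smul' := fun c a => by rw [map_smul, ContinuousLinearMap.rTensor_smul]; rfl }
      (by simp) (fun a b => by simp [ContinuousLinearMap.rTensor_mul]))
    (AlgHom.ofLinearMap
      { toFun := fun b => (ρ b).lTensor H
        map_add' := fun a b => by rw [map_add, ContinuousLinearMap.lTensor_add]
        map_smul' := fun c a => by rw [map_smul, ContinuousLinearMap.lTensor_smul]; rfl }
      (by simp) (fun a b => by simp [ContinuousLinearMap.lTensor_mul]))
    (fun a b => by
      change (π a).rTensor K * (ρ b).lTensor H = (ρ b).lTensor H * (π a).rTensor K
      exact (ContinuousLinearMap.rTensor_comp_lTensor (π a) (ρ b)).trans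
        (ContinuousLinearMap.lTensor_comp_rTensor (ρ b) (π a)).symm)

theorem tensorRep_tmul (π : A →⋆ₐ[ℂ] (H →L[ℂ] H)) (ρ : B →⋆ₐ[ℂ] (K →L[ℂ] K)) (a : A) (b : B)
    (x : H) (y : K) : tensorRep π ρ (a ⊗ₜ b) (x ⊗ₜ y) = π a x ⊗ₜ ρ b y := by
  simp [tensorRep]

theorem norm_tensorRep_tmul_le (π : A →⋆ₐ[ℂ] (H →L[ℂ] H)) (ρ : B →⋆ₐ[ℂ] (K →L[ℂ] K)) (a : A)
    (b : B) : ‖tensorRep π ρ (a ⊗ₜ b)‖ ≤ ‖a‖ * ‖b‖ := by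
  have h : tensorRep π ρ (a ⊗ₜ b) = TensorProduct.mapL (π a) (ρ b) := by
    ext x
    induction x with
    | zero => simp
    | add x y hx hy => rw [map_add, map_add, hx, hy]
    | tmul x y => rw [tensorRep_tmul, TensorProduct.mapL_tmul]
  rw [h]
  exact (TensorProduct.norm_mapL_le _ _).trans
    (mul_le_mul (NonUnitalStarAlgHom.norm_apply_le π a) (NonUnitalStarAlgHom.norm_apply_le ρ b)
      (norm_nonneg _) (norm_nonneg _))

theorem inner_tensorRep_star (π : A →⋆ₐ[ℂ] (H →L[ℂ] H)) (ρ : B →⋆ₐ[ℂ] (K →L[ℂ] K)) (t : A ⊗[ℂ] B)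
    (x y : H ⊗[ℂ] K) : ⟪tensorRep π ρ t x, y⟫_ℂ = ⟪x, tensorRep π ρ (star t) y⟫_ℂ := by
  induction t with
  | zero => simp
  | add s t hs ht =>
    simp only [map_add, star_add, add_apply, inner_add_left, inner_add_right,
      hs, ht]
  | tmul a b =>
    induction x with
    | zero => simp
    | add x x' hx hx' => simp only [map_add, inner_add_left, hx, hx']
    | tmul x x' =>
      induction y with
      | zero => simp
      | add y y' hy hy' => simp only [map_add, inner_add_right, hy, hy']
      | tmul y y' =>
        simp only [TensorProduct.star_tmul, tensorRep_tmul, TensorProduct.inner_tmul, map_star,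
          ContinuousLinearMap.star_eq_adjoint, ContinuousLinearMap.adjoint_inner_right]

/-- The C⋆-seminorm `t ↦ ‖(π ⊗ ρ) t‖` on the algebraic tensor product. -/
def spatialSeminorm (π : A →⋆ₐ[ℂ] (H →L[ℂ] H)) (ρ : B →⋆ₐ[ℂ] (K →L[ℂ] K)) :
    CStarSeminorm (A ⊗[ℂ] B) :=
  { (normSeminorm ℂ ((H ⊗[ℂ] K) →L[ℂ] (H ⊗[ℂ] K))).comp (tensorRep π ρ).toLinearMap with
    mul_le' := fun s t => by
      change ‖tensorRep π ρ (s * t)‖ ≤ ‖tensorRep π ρ s‖ * ‖tensorRep π ρ t‖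
      rw [map_mul]
      exact ContinuousLinearMap.opNorm_comp_le _ _
    star_mul_self' := fun t => by
      change ‖tensorRep π ρ (star t * t)‖ = ‖tensorRep π ρ t‖ ^ 2
      have key : ∀ t : A ⊗[ℂ] B,
          ‖tensorRep π ρ t‖ ^ 2 ≤ ‖tensorRep π ρ (star t * t)‖ := fun t => by
        have h : ‖tensorRep π ρ t‖ ≤ √‖tensorRep π ρ (star t * t)‖ := by
          refine ContinuousLinearMap.opNorm_le_bound _ (Real.sqrt_nonneg _) fun x => ?_
          refine abs_le_of_sq_le_sq' ?_ (by positivity) |>.2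
          rw [mul_pow, Real.sq_sqrt (ContinuousLinearMap.opNorm_nonneg _), ← inner_self_eq_norm_sq (𝕜 := ℂ),
            inner_tensorRep_star]
          have hcs := norm_inner_le_norm (𝕜 := ℂ) x
            (tensorRep π ρ (star t) (tensorRep π ρ t x))
          refine (RCLike.re_le_norm _).trans (hcs.trans ?_)
          have h1 : tensorRep π ρ (star t) (tensorRep π ρ t x) = tensorRep π ρ (star t * t) x := by
            rw [map_mul]
            rfl
          rw [h1, pow_two, mul_comm, ← mul_assoc]
          exact mul_le_mul_of_nonneg_right (ContinuousLinearMap.le_opNorm _ _) (norm_nonneg _)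
        calc ‖tensorRep π ρ t‖ ^ 2 ≤ √‖tensorRep π ρ (star t * t)‖ ^ 2 := by gcongr
          _ = _ := Real.sq_sqrt (ContinuousLinearMap.opNorm_nonneg _)
      have hmul : ∀ t : A ⊗[ℂ] B, ‖tensorRep π ρ (star t * t)‖ ≤
          ‖tensorRep π ρ (star t)‖ * ‖tensorRep π ρ t‖ := fun t => by
        rw [map_mul]
        exact ContinuousLinearMap.opNorm_comp_le _ _
      have hstar : ∀ t : A ⊗[ℂ] B, ‖tensorRep π ρ t‖ ≤ ‖tensorRep π ρ (star t)‖ := fun t => by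
        by_contra h
        push Not at h
        nlinarith [key t, hmul t, ContinuousLinearMap.opNorm_nonneg (tensorRep π ρ t),
          ContinuousLinearMap.opNorm_nonneg (tensorRep π ρ (star t))]
      have h2 : ‖tensorRep π ρ (star t)‖ ≤ ‖tensorRep π ρ t‖ := by simpa using hstar (star t)
      refine le_antisymm ((hmul t).trans ?_) (key t)
      rw [pow_two]
      exact mul_le_mul_of_nonneg_right h2 (ContinuousLinearMap.opNorm_nonneg _) }

theorem spatialSeminorm_apply (π : A →⋆ₐ[ℂ] (H →L[ℂ] H)) (ρ : B →⋆ₐ[ℂ] (K →L[ℂ] K))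
    (t : A ⊗[ℂ] B) : (spatialSeminorm π ρ).toSeminorm t = ‖tensorRep π ρ t‖ := rfl

variable (A B) in
/-- The minimal (spatial) C⋆-norm on `A ⊗ B`: the supremum of `‖(π ⊗ ρ) t‖` over all pairs of
representations `π`, `ρ` of `A` and `B` on Hilbert spaces. -/
def minSeminorm : CStarSeminorm (A ⊗[ℂ] B) :=
  CStarSeminorm.sup
    {p | ∃ (H K : Type) (_ : NormedAddCommGroup H) (_ : InnerProductSpace ℂ H)
      (_ : CompleteSpace H) (_ : NormedAddCommGroup K) (_ : InnerProductSpace ℂ K)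
      (_ : CompleteSpace K) (π : A →⋆ₐ[ℂ] (H →L[ℂ] H)) (ρ : B →⋆ₐ[ℂ] (K →L[ℂ] K)),
      p = spatialSeminorm π ρ} (by
      intro t
      induction t with
      | zero =>
        exact ⟨0, fun p _ => (map_zero p.toSeminorm).le⟩
      | add s t hs ht =>
        obtain ⟨C, hC⟩ := hs
        obtain ⟨D, hD⟩ := ht
        exact ⟨C + D, fun p hp => (map_add_le_add p.toSeminorm s t).trans
          (add_le_add (hC p hp) (hD p hp))⟩
      | tmul a b =>
        refine ⟨‖a‖ * ‖b‖, ?_⟩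
        rintro _ ⟨H, K, _, _, _, _, _, _, π, ρ, rfl⟩
        exact norm_tensorRep_tmul_le π ρ a b)

variable (A B) in
/-- The minimal C⋆-tensor product of two unital C⋆-algebras. -/
abbrev MinTensor : Type := (minSeminorm A B).Completion

/-- The elementary tensor `a ⊗ b` in the minimal tensor product. -/
def minTmul (a : A) (b : B) : MinTensor A B := (minSeminorm A B).of (a ⊗ₜ b)

variable {A' B' : Type} [CStarAlgebra A'] [CStarAlgebra B']

/-- The ⋆-homomorphism `Φ ⊗ Ψ` between algebraic tensor products. -/
def algTensorMap (Φ : A →⋆ₐ[ℂ] A') (Ψ : B →⋆ₐ[ℂ] B') : A ⊗[ℂ] B →⋆ₐ[ℂ] A' ⊗[ℂ] B' :=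
  { Algebra.TensorProduct.map (Φ : A →ₐ[ℂ] A') (Ψ : B →ₐ[ℂ] B') with
    map_star' := fun t => by
      change Algebra.TensorProduct.map (Φ : A →ₐ[ℂ] A') (Ψ : B →ₐ[ℂ] B') (star t) =
        star (Algebra.TensorProduct.map (Φ : A →ₐ[ℂ] A') (Ψ : B →ₐ[ℂ] B') t)
      induction t with
      | zero => simp
      | add s t hs ht => simp only [star_add, map_add, hs, ht]
      | tmul a b => simp [TensorProduct.star_tmul, map_star] }

theorem algTensorMap_tmul (Φ : A →⋆ₐ[ℂ] A') (Ψ : B →⋆ₐ[ℂ] B') (a : A) (b : B) :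
    algTensorMap Φ Ψ (a ⊗ₜ b) = Φ a ⊗ₜ Ψ b := rfl

/-- The ⋆-homomorphism `Φ ⊗ Ψ` between minimal tensor products. -/
def minTensorMap (Φ : A →⋆ₐ[ℂ] A') (Ψ : B →⋆ₐ[ℂ] B') : MinTensor A B →⋆ₐ[ℂ] MinTensor A' B' :=
  CStarSeminorm.map (algTensorMap Φ Ψ) (by
    intro t
    refine Real.iSup_le ?_ (apply_nonneg _ _)
    rintro ⟨_, H, K, _, _, _, _, _, _, π, ρ, rfl⟩
    have h : tensorRep π ρ (algTensorMap Φ Ψ t) = tensorRep (π.comp Φ) (ρ.comp Ψ) t := by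
      induction t with
      | zero => simp
      | add s t hs ht => simp only [map_add, hs, ht]
      | tmul a b => rfl
    change ‖tensorRep π ρ (algTensorMap Φ Ψ t)‖ ≤ _
    rw [h]
    refine CStarSeminorm.le_sup _ _ (spatialSeminorm (π.comp Φ) (ρ.comp Ψ)) ?_ t
    exact ⟨H, K, _, _, inferInstance, _, _, inferInstance, _, _, rfl⟩)

theorem minTensorMap_minTmul (Φ : A →⋆ₐ[ℂ] A') (Ψ : B →⋆ₐ[ℂ] B') (a : A) (b : B) :
    minTensorMap Φ Ψ (minTmul a b) = minTmul (Φ a) (Ψ b) :=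
  CStarSeminorm.map_of _ _ _

end MinTensor

/-! ### Matrix quantum groups and their isomorphisms -/

/-- `Δ` is the comultiplication of the matrix quantum group with fundamental corepresentation `u`:
`Δ (u i j) = ∑ k, u i k ⊗ u k j`. (If the entries of `u` generate `A`, there is at most one.) -/
def IsComultiplication {ι A : Type} [Fintype ι] [CStarAlgebra A] (u : Matrix ι ι A)
    (Δ : A →⋆ₐ[ℂ] MinTensor A A) : Prop :=
  ∀ i j, Δ (u i j) = ∑ k, minTmul (u i k) (u k j)

/-- The compact matrix quantum groups `(A, u)` and `(B, w)` are isomorphic: there is an isomorphism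
of C⋆-algebras that intertwines the comultiplications. -/
def QuantumGroupIso {ι κ A B : Type} [Fintype ι] [Fintype κ] [CStarAlgebra A] [CStarAlgebra B]
    (u : Matrix ι ι A) (w : Matrix κ κ B) : Prop :=
  ∃ (ΔA : A →⋆ₐ[ℂ] MinTensor A A) (ΔB : B →⋆ₐ[ℂ] MinTensor B B),
    IsComultiplication u ΔA ∧ IsComultiplication w ΔB ∧
      ∃ Φ : A ≃⋆ₐ[ℂ] B, ∀ x, ΔB (Φ x) = minTensorMap (Φ : A →⋆ₐ[ℂ] B) (Φ : A →⋆ₐ[ℂ] B) (ΔA x)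

/-! ### The Woronowicz construction in dimension three -/

/-- The permutation condition: `E i j k ≠ 0` exactly when `(i, j, k)` is a permutation. -/
def PermutationCondition (E : Fin 3 → Fin 3 → Fin 3 → ℂ) : Prop :=
  ∀ i j k, E i j k ≠ 0 ↔ i ≠ j ∧ i ≠ k ∧ j ≠ k

/-- The unitarity and the twisted determinant relations for the array `E`. -/
def woronowiczRelators (E : Fin 3 → Fin 3 → Fin 3 → ℂ) : Set (FreeStarAlgebra (Fin 3 × Fin 3)) :=
  let u : Fin 3 → Fin 3 → FreeStarAlgebra (Fin 3 × Fin 3) := fun i j => FreeStarAlgebra.gen (i, j)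
  {r | ∃ j k, r = ∑ s, u j s * star (u k s) - if j = k then 1 else 0} ∪
  {r | ∃ j k, r = ∑ s, star (u s j) * u s k - if j = k then 1 else 0} ∪
  {r | ∃ a b c, r = ∑ i, ∑ j, ∑ k, E i j k • (u a i * u b j * u c k) - E a b c • 1}

/-- The C⋆-algebra of the compact quantum group related to `E`, coming from the Woronowicz
construction. -/
abbrev WoronowiczAlgebra (E : Fin 3 → Fin 3 → Fin 3 → ℂ) : Type :=
  UniversalCStar (woronowiczRelators E)

/-- The fundamental corepresentation of the compact quantum group related to `E`. -/
def woronowiczMatrix (E : Fin 3 → Fin 3 → Fin 3 → ℂ) :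
    Matrix (Fin 3) (Fin 3) (WoronowiczAlgebra E) :=
  Matrix.of fun i j => UniversalCStar.gen (woronowiczRelators E) (i, j)

/-- The universal property of the C⋆-algebra related to `E`. -/
theorem WoronowiczAlgebra.exists_hom {E : Fin 3 → Fin 3 → Fin 3 → ℂ} {B : Type*} [CStarAlgebra B]
    (w : Matrix (Fin 3) (Fin 3) B)
    (h1 : ∀ j k, ∑ s, w j s * star (w k s) = if j = k then 1 else 0)
    (h2 : ∀ j k, ∑ s, star (w s j) * w s k = if j = k then 1 else 0)
    (h3 : ∀ a b c, ∑ i, ∑ j, ∑ k, E i j k • (w a i * w b j * w c k) = E a b c • 1) :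
    ∃ φ : WoronowiczAlgebra E →⋆ₐ[ℂ] B, ∀ i j, φ (woronowiczMatrix E i j) = w i j := by
  obtain ⟨φ, hφ⟩ := UniversalCStar.exists_hom (R := woronowiczRelators E)
    (fun x : Fin 3 × Fin 3 => w x.1 x.2) (by
      have hδ : ∀ j k : Fin 3, FreeStarAlgebra.eval (fun x : Fin 3 × Fin 3 => w x.1 x.2)
          (if j = k then 1 else 0) = if j = k then 1 else 0 := by
        intro j k
        split_ifs <;> simp
      rintro r ((⟨j, k, rfl⟩ | ⟨j, k, rfl⟩) | ⟨a, b, c, rfl⟩)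
      · simp only [map_sub, map_sum, map_mul, map_star, FreeStarAlgebra.eval_gen, h1, hδ, sub_self]
      · simp only [map_sub, map_sum, map_mul, map_star, FreeStarAlgebra.eval_gen, h2, hδ, sub_self]
      · simp only [map_sub, map_sum, map_smul, map_mul, FreeStarAlgebra.eval_gen, h3, map_one,
          sub_self])
    (fun x => norm_le_one_of_sum_star_mul_self (fun s => w s x.2) (by simpa using h2 x.2 x.2) x.1)
  exact ⟨φ, fun i j => hφ (i, j)⟩

/-! ### The quantum group `U_q(2)` -/

/-- The generators of the C⋆-algebra of `U_q(2)`. -/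
inductive UqGenerator : Type
  | a | c | v

open FreeStarAlgebra in
/-- The defining relations of the C⋆-algebra of `U_q(2)`, where `q = |q| exp (i t)`. -/
def uqRelators (q : ℂ) : Set (FreeStarAlgebra UqGenerator) :=
  let a : FreeStarAlgebra UqGenerator := gen .a
  let c : FreeStarAlgebra UqGenerator := gen .c
  let v : FreeStarAlgebra UqGenerator := gen .v
  let t : ℂ := (Complex.arg q : ℂ)
  {a * c - star q • (c * a), a * star c - q • (star c * a), star a * a + star c * c - 1,
    a * star a + ((‖q‖ : ℂ) ^ 2) • (star c * c) - 1, c * star c - star c * c,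
    v * star v - 1, star v * v - 1, a * v - v * a,
    c * v - Complex.exp (-2 * Complex.I * t) • (v * c)}

/-- The C⋆-algebra of `U_q(2)`. -/
abbrev UqAlgebra (q : ℂ) : Type := UniversalCStar (uqRelators q)

/-- The universal property of the C⋆-algebra of `U_q(2)`. -/
theorem UqAlgebra.exists_hom {q : ℂ} {B : Type*} [CStarAlgebra B] (w : UqGenerator → B)
    (hw : ∀ r ∈ uqRelators q, FreeStarAlgebra.eval w r = 0) :
    ∃ φ : UqAlgebra q →⋆ₐ[ℂ] B, ∀ x, φ (UniversalCStar.gen (uqRelators q) x) = w x := by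
  refine UniversalCStar.exists_hom w hw fun x => ?_
  have h1 := hw (star (FreeStarAlgebra.gen .a) * FreeStarAlgebra.gen .a +
    star (FreeStarAlgebra.gen .c) * FreeStarAlgebra.gen .c - 1) (by simp [uqRelators])
  have h2 := hw (star (FreeStarAlgebra.gen .v) * FreeStarAlgebra.gen .v - 1) (by simp [uqRelators])
  simp only [map_sub, map_add, map_mul, map_star, map_one, FreeStarAlgebra.eval_gen,
    sub_eq_zero] at h1 h2
  cases x with
  | a => exact norm_le_one_of_sum_star_mul_self ![w .a, w .c] (by simpa using h1) 0
  | c => exact norm_le_one_of_sum_star_mul_self ![w .a, w .c] (by simpa using h1) 1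
  | v => exact norm_le_one_of_sum_star_mul_self ![w .v] (by simpa using h2) 0
/-- The fundamental corepresentation of `U_q(2)`. -/
def uqMatrix (q : ℂ) : Matrix (Fin 3) (Fin 3) (UqAlgebra q) :=
  let a : UqAlgebra q := UniversalCStar.gen (uqRelators q) .a
  let c : UqAlgebra q := UniversalCStar.gen (uqRelators q) .c
  let v : UqAlgebra q := UniversalCStar.gen (uqRelators q) .v
  !![v, 0, 0;
     0, a, -(q • (star c * star v));
     0, c, star a * star v]

/-! ### The two-dimensional torus -/

/-- The fundamental corepresentation `diag (z₁, z₂)` of `C(𝕋²)`, where `𝕋²` is the group of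
diagonal unitary `2 × 2` matrices. -/
def torusMatrix : Matrix (Fin 2) (Fin 2) C(Circle × Circle, ℂ) :=
  Matrix.diagonal ![⟨fun z => (z.1 : ℂ), by fun_prop⟩, ⟨fun z => (z.2 : ℂ), by fun_prop⟩]

end

open scoped TensorProduct InnerProductSpace

set_option linter.unusedSimpArgs false
set_option linter.unusedSectionVars false

noncomputable section

/-! ### Relations in star algebras -/

/-! Relabel the indices so that the isolated one is 0, write `v = u 0 0` (a unitary), and let `q =
-(E 0 2 1 / E 0 1 2)`. In the cubic relations that involve the index 0, all but two terms vanish.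
Depending on the place of 0 one gets three quadratic relations for the `2 × 2` block: `v` cancels
when 0 is in first or last place, and stays between the two factors when 0 is in the middle.

The relations with 0 in first place form a twisted quantum determinant. Combined with unitarity they
already force the relations of `U_q(2)`: multiplying by the adjoint of the block expresses the
second column through the first and `v` (`uqRelations_of_unitary`). Conversely, the fundamental
matrix of `U_q(2)` satisfies all cubic relations when the last-place ratio agrees with the
first-place one and the middle ratio is its conjugate (`UqRelations.woronowiczRelations`). The
conjugate enters because `c` and `v` commute only up to the phase of `q̄/q`. If the conditions hold,
the two universal properties give mutually inverse homomorphisms (`quantumGroupIso_uqMatrix`).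

If a condition fails, the block is diagonal (`diagonal_of_not_compatible`). When the outer ratios
differ, the first-place and last-place relations form an invertible linear system that determines
the products of the entries. When only the middle one is wrong, the middle relation becomes a
nonzero multiple of `c⋆ c = 0`. A diagonal solution consists of two commuting unitaries and the
adjoint of their product, so the algebra is `C(𝕋²)` by Gelfand duality and Stone–Weierstrass
(`quantumGroupIso_torusMatrix`).

It remains to separate the two cases. A diagonal fundamental matrix has group-like entries, so the
comultiplication is symmetric. In `U_q(2)`, slicing `Δ c` on the left and on the right by a suitable
character gives `c` with opposite signs (`not_quantumGroupIso_uqMatrix_of_diagonal`). This is a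
contradiction because `c ≠ 0`, as an explicit representation on `ℓ²(ℕ × ℤ)` shows
(`exists_uqRelations`). -/

/-- The relations between the entries of the fundamental corepresentation related to `E`. -/
structure WoronowiczRelations (E : Fin 3 → Fin 3 → Fin 3 → ℂ) {B : Type*} [Ring B] [StarRing B]
    [Algebra ℂ B] (w : Matrix (Fin 3) (Fin 3) B) : Prop where
  row : ∀ j k, ∑ s, w j s * star (w k s) = if j = k then 1 else 0
  col : ∀ j k, ∑ s, star (w s j) * w s k = if j = k then 1 else 0
  det : ∀ a b c, ∑ i, ∑ j, ∑ k, E i j k • (w a i * w b j * w c k) = E a b c • (1 : B)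

/-- The relations between the generators of the algebra of `U_q(2)`. -/
structure UqRelations (q : ℂ) {B : Type*} [Ring B] [StarRing B] [Algebra ℂ B] (a c v : B) :
    Prop where
  a_mul_c : a * c = star q • (c * a)
  a_mul_star_c : a * star c = q • (star c * a)
  star_a_mul_a : star a * a + star c * c = 1
  a_mul_star_a : a * star a + ((‖q‖ : ℂ) ^ 2) • (star c * c) = 1
  c_mul_star_c : c * star c = star c * c
  v_mul_star_v : v * star v = 1
  star_v_mul_v : star v * v = 1
  a_mul_v : a * v = v * a
  c_mul_v : c * v = Complex.exp (-2 * Complex.I * (Complex.arg q : ℂ)) • (v * c)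

/-- This removes the argument of `q` from the relation between `c` and `v`: the phase is `q̄ / q`,
so all later computations are algebraic in `q` and `star q`. -/
theorem mul_exp_neg_two_arg (q : ℂ) :
    q * Complex.exp (-2 * Complex.I * (Complex.arg q : ℂ)) = star q := by
  have h1 : star q = ‖q‖ * Complex.exp (-(Complex.arg q * Complex.I)) := by
    conv_lhs => rw [← Complex.norm_mul_exp_arg_mul_I q]
    simp only [star_mul', Complex.star_def, Complex.conj_ofReal, ← Complex.exp_conj, map_mul,
      Complex.conj_I, mul_neg]
  rw [h1]
  nth_rw 1 [← Complex.norm_mul_exp_arg_mul_I q]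
  rw [mul_assoc, ← Complex.exp_add]
  congr 2
  ring

theorem norm_sq_eq_mul_star (q : ℂ) : (‖q‖ : ℂ) ^ 2 = q * star q :=
  (Complex.mul_conj' q).symm

/-! ### From the quantum determinant to the relations of `U_q(2)` -/

section Block

variable {B : Type*} [Ring B] [StarRing B] [Algebra ℂ B] [StarModule ℂ B]

/-- The quantum determinant relation of a unitary `2 × 2` matrix forces the relations of
`U_q(2)`. -/
theorem uqRelations_of_unitary {q : ℂ} (hq : q ≠ 0) {α β γ δ v : B}
    (hv1 : v * star v = 1) (hv2 : star v * v = 1)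
    (c11 : star α * α + star γ * γ = 1) (c12 : star α * β + star γ * δ = 0)
    (c21 : star β * α + star δ * γ = 0) (c22 : star β * β + star δ * δ = 1)
    (d11 : α * β - q • (β * α) = 0) (d12 : α * δ - q • (β * γ) = star v)
    (d21 : γ * β - q • (δ * α) = -(q • star v)) (d22 : γ * δ - q • (δ * γ) = 0) :
    UqRelations q α γ v ∧ β = -(q • (star γ * star v)) ∧ δ = star α * star v := by
  -- The next four identities come from multiplying the determinant relations on the left by the
  -- adjoint of the block. The column relations `c11`, `c12`, `c21`, `c22` collapse the result to a
  -- single entry.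
  have hδ : δ = star α * star v := by
    linear_combination (norm := (simp only [mul_add, add_mul, mul_sub, sub_mul, mul_smul_comm,
      mul_neg, neg_mul, smul_mul_assoc, smul_smul, mul_assoc, one_mul, mul_one,
      mul_zero, zero_mul, smul_zero]; module))
      -(c11 * δ) + star α * d12 + star γ * d22 + q • (c12 * γ)
  have hγ : -(q • γ) = star β * star v := by
    linear_combination (norm := (simp only [mul_add, add_mul, mul_sub, sub_mul, mul_smul_comm,
      mul_neg, neg_mul, smul_mul_assoc, smul_smul, mul_assoc, one_mul, mul_one,
      mul_zero, zero_mul, smul_zero]; module))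
      star β * d12 + star δ * d22 + q • (c22 * γ) - c21 * δ
  have hβ : β = -(q • (star γ * star v)) := by
    linear_combination (norm := (simp only [mul_add, add_mul, mul_sub, sub_mul, mul_smul_comm,
      mul_neg, neg_mul, smul_mul_assoc, smul_smul, mul_assoc, one_mul, mul_one,
      mul_zero, zero_mul, smul_zero]; module))
      -(c11 * β) + star α * d11 + star γ * d21 + q • (c12 * α)
  have hα : q • α = q • (star δ * star v) := by
    linear_combination (norm := (simp only [mul_add, add_mul, mul_sub, sub_mul, mul_smul_comm,
      mul_neg, neg_mul, smul_mul_assoc, smul_smul, mul_assoc, one_mul, mul_one,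
      mul_zero, zero_mul, smul_zero]; module))
      -(star β * d11) - star δ * d21 - q • (c22 * α) + c21 * β
  have hα : α = star δ * star v := (smul_right_injective B hq) hα
  -- `α` and `δ` are each expressed through the other, and so are `β` and `γ`. Substituting one
  -- formula into the other gives the commutation with `v`.
  have hav : α * v = v * α := by
    have h1 : star δ = v * α := by rw [hδ, star_mul, star_star, star_star]
    rw [h1] at hα
    nth_rw 1 [hα]
    rw [mul_assoc, hv2, mul_one]
  have hcv : q • (γ * v) = star q • (v * γ) := by
    have h1 : star β = -(star q • (v * γ)) := by
      rw [hβ, star_neg, star_smul, star_mul, star_star, star_star]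
    rw [h1, neg_mul, neg_inj] at hγ
    rw [← smul_mul_assoc, hγ, mul_assoc, hv2, mul_one]
  have hvs : v * star α = star α * v := by
    have : star α * star v = star v * star α := by rw [← star_mul, ← star_mul, hav]
    calc v * star α = v * (star α * star v) * v := by rw [mul_assoc, mul_assoc, hv2, mul_one]
      _ = star α * v := by rw [this, ← mul_assoc, hv1, one_mul]
  have hsv : q • (star v * γ) = star q • (γ * star v) := by
    linear_combination (norm := (simp only [mul_add, add_mul, mul_sub, sub_mul, mul_smul_comm,
      mul_neg, neg_mul, smul_mul_assoc, smul_smul, mul_assoc, one_mul, mul_one,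
      mul_zero, zero_mul, smul_zero]; module))
      star v * hcv * star v - q • (star v * γ * hv1) + star q • (hv2 * γ * star v)
  have hvs' : star v * α = α * star v := by
    simpa using congrArg star hvs.symm
  subst hδ hβ
  -- With the second column eliminated, the open relations come, in this order, from `c12`, `d11`,
  -- `d12`, `d21` (with `c11`) and `hcv`.
  refine ⟨⟨?_, ?_, c11, ?_, ?_, hv1, hv2, hav, ?_⟩, rfl, rfl⟩
  · have h1 : star γ * star α = q • (star α * star γ) := by
      linear_combination (norm := (simp only [mul_add, add_mul, mul_sub, sub_mul, mul_smul_comm,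
      mul_neg, neg_mul, smul_mul_assoc, smul_smul, mul_assoc, one_mul, mul_one,
      mul_zero, zero_mul, smul_zero]; module))
        c12 * v - star γ * star α * hv2 + q • (star α * star γ * hv2)
    have h2 := congrArg star h1
    rwa [star_smul, star_mul, star_mul, star_star, star_star] at h2
  · refine smul_right_injective B hq ?_
    linear_combination (norm := (simp only [mul_add, add_mul, mul_sub, sub_mul, mul_smul_comm,
      mul_neg, neg_mul, smul_mul_assoc, smul_smul, mul_assoc, one_mul, mul_one,
      mul_zero, zero_mul, smul_zero]; module))
      -(d11 * v) - q • (α * star γ * hv2) + q • q • (star γ * hvs' * v) + q • q • (star γ * α * hv2)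
  · rw [norm_sq_eq_mul_star]
    linear_combination (norm := (simp only [mul_add, add_mul, mul_sub, sub_mul, mul_smul_comm,
      mul_neg, neg_mul, smul_mul_assoc, smul_smul, mul_assoc, one_mul, mul_one,
      mul_zero, zero_mul, smul_zero]; module))
      d12 * v - α * star α * hv2 - q • (star γ * hsv * v) - (q * star q) • (star γ * γ * hv2) + hv2
  · refine smul_right_injective B hq ?_
    linear_combination (norm := (simp only [mul_add, add_mul, mul_sub, sub_mul, mul_smul_comm,
      mul_neg, neg_mul, smul_mul_assoc, smul_smul, mul_assoc, one_mul, mul_one,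
      mul_zero, zero_mul, smul_zero]; module))
      -(d21 * v) - q • (γ * star γ * hv2) - q • (star α * hvs' * v) - q • (star α * α * hv2)
        - q • c11 + q • hv2
  · refine smul_right_injective B hq ?_
    simp only [smul_smul, mul_exp_neg_two_arg]
    exact hcv

end Block

/-! ### Normal ordering in `U_q(2)` -/

section NormalForm

/-- The form of a commutation rule that rewrites inside a right-associated product. -/
theorem mul_mul_eq_smul_of_mul_eq_smul {B : Type*} [Ring B] [Algebra ℂ B] {x y z w : B} {s : ℂ}
    (h : x * y = s • (z * w)) (t : B) : x * (y * t) = s • (z * (w * t)) := by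
  rw [← mul_assoc, h, smul_mul_assoc, mul_assoc]

variable {q : ℂ} {B : Type*} [Ring B] [StarRing B] [Algebra ℂ B] [StarModule ℂ B] {a c v : B}

namespace UqRelations

theorem star_a_mul_c (h : UqRelations q a c v) (hq : q ≠ 0) :
    star a * c = (star q)⁻¹ • (c * star a) := by
  have h1 := congrArg star h.a_mul_star_c
  rw [star_smul, star_mul, star_mul, star_star] at h1
  rw [h1, smul_smul, inv_mul_cancel₀ (star_ne_zero.2 hq), one_smul]

theorem star_a_mul_star_c (h : UqRelations q a c v) (hq : q ≠ 0) :
    star a * star c = q⁻¹ • (star c * star a) := by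
  have h1 := congrArg star h.a_mul_c
  rw [star_smul, star_mul, star_mul, star_star] at h1
  rw [h1, smul_smul, inv_mul_cancel₀ hq, one_smul]

theorem star_a_mul_star_v (h : UqRelations q a c v) : star a * star v = star v * star a := by
  rw [← star_mul, ← star_mul, h.a_mul_v]

theorem a_mul_star_v (h : UqRelations q a c v) : a * star v = star v * a := by
  linear_combination (norm := noncomm_ring)
    -(h.star_v_mul_v * a * star v) + star v * a * h.v_mul_star_v - star v * h.a_mul_v * star v

theorem star_a_mul_v (h : UqRelations q a c v) : star a * v = v * star a := by
  simpa using congrArg star h.a_mul_star_v.symm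

theorem c_mul_v_eq (h : UqRelations q a c v) (hq : q ≠ 0) :
    c * v = (q⁻¹ * star q) • (v * c) := by
  rw [h.c_mul_v, ← mul_exp_neg_two_arg, inv_mul_cancel_left₀ hq]

theorem c_mul_star_v (h : UqRelations q a c v) (hq : q ≠ 0) :
    c * star v = (q * (star q)⁻¹) • (star v * c) := by
  have h0 : star q ≠ 0 := star_ne_zero.2 hq
  have h1 : star v * c = (q⁻¹ * star q) • (c * star v) := by
    linear_combination (norm := (simp only [mul_add, add_mul, mul_sub, sub_mul, mul_smul_comm,
      mul_neg, neg_mul, smul_mul_assoc, smul_smul, mul_assoc, one_mul, mul_one,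
      mul_zero, zero_mul, smul_zero]; module))
      star v * h.c_mul_v_eq hq * star v - star v * c * h.v_mul_star_v
        + (q⁻¹ * star q) • (h.star_v_mul_v * c * star v)
  rw [h1, smul_smul, show q * (star q)⁻¹ * (q⁻¹ * star q) = 1 by field_simp, one_smul]

theorem star_c_mul_v (h : UqRelations q a c v) (hq : q ≠ 0) :
    star c * v = (q * (star q)⁻¹) • (v * star c) := by
  have h0 : star q ≠ 0 := star_ne_zero.2 hq
  have h1 := congrArg star (h.c_mul_star_v hq)
  simp only [star_smul, star_mul, star_star, star_inv₀, star_mul'] at h1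
  rw [h1, smul_smul, show q * (star q)⁻¹ * (q⁻¹ * star q) = 1 by field_simp, one_smul]

theorem star_c_mul_star_v (h : UqRelations q a c v) (hq : q ≠ 0) :
    star c * star v = (q⁻¹ * star q) • (star v * star c) := by
  have h0 : star q ≠ 0 := star_ne_zero.2 hq
  have h1 := congrArg star (h.c_mul_v_eq hq)
  simp only [star_smul, star_mul, star_star, star_inv₀, star_mul'] at h1
  rw [h1, smul_smul, show q⁻¹ * star q * (q * (star q)⁻¹) = 1 by field_simp, one_smul]

/-- Exchanging the two indices of the block puts its second column, read from bottom to top, in the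
place of `(a, c)` and inverts `q`. This symmetry reduces `‖q‖ ≥ 1` to `‖q‖ ≤ 1`. -/
theorem inv (h : UqRelations q a c v) (hq : q ≠ 0) :
    UqRelations q⁻¹ (star a * star v) (-(q • (star c * star v))) v := by
  have h0 : star q ≠ 0 := star_ne_zero.2 hq
  have e1 : ∀ t, a * (v * t) = v * (a * t) := fun t => by rw [← mul_assoc, h.a_mul_v, mul_assoc]
  have e1' : ∀ t, a * (star v * t) = star v * (a * t) := fun t => by
    rw [← mul_assoc, h.a_mul_star_v, mul_assoc]
  have e2 : ∀ t, star a * (v * t) = v * (star a * t) := fun t => by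
    rw [← mul_assoc, h.star_a_mul_v, mul_assoc]
  have e3 : ∀ t, star a * (star v * t) = star v * (star a * t) := fun t => by
    rw [← mul_assoc, h.star_a_mul_star_v, mul_assoc]
  have e4 : ∀ t, v * (star v * t) = t := fun t => by rw [← mul_assoc, h.v_mul_star_v, one_mul]
  have e5 : ∀ t, star v * (v * t) = t := fun t => by rw [← mul_assoc, h.star_v_mul_v, one_mul]
  have e6 := h.c_mul_v_eq hq
  have e7 := h.c_mul_star_v hq
  have e8 := h.star_c_mul_v hq
  have e9 := h.star_c_mul_star_v hq
  have e10 := fun t => mul_mul_eq_smul_of_mul_eq_smul e6 t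
  have e11 := fun t => mul_mul_eq_smul_of_mul_eq_smul e7 t
  have e12 := fun t => mul_mul_eq_smul_of_mul_eq_smul e8 t
  have e13 := fun t => mul_mul_eq_smul_of_mul_eq_smul e9 t
  have e14 : a * star a = 1 - (q * star q) • (star c * c) := by
    rw [← norm_sq_eq_mul_star, ← h.a_mul_star_a, add_sub_cancel_right]
  have e15 : star a * a = 1 - star c * c := by rw [← h.star_a_mul_a, add_sub_cancel_right]
  have e16 : ∀ t, c * (star c * t) = star c * (c * t) := fun t => by
    rw [← mul_assoc, h.c_mul_star_c, mul_assoc]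
  have e17 : ∀ t, a * (star a * t) = t - (q * star q) • (star c * (c * t)) := fun t => by
    rw [← mul_assoc, e14, sub_mul, one_mul, smul_mul_assoc, mul_assoc]
  have hz := mul_exp_neg_two_arg q⁻¹
  rw [mul_comm, ← eq_div_iff (inv_ne_zero hq)] at hz
  have hn : (‖q⁻¹‖ : ℂ) ^ 2 = q⁻¹ * star q⁻¹ := norm_sq_eq_mul_star _
  -- Each relation is checked by moving `v` and `star v` to the left and `a`, `star a` to the right,
  -- with `star c` before `c` in between, and then comparing scalars.
  constructor
  all_goals
    try rw [hz]
    try rw [hn]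
    simp only [star_mul, star_star, star_neg, star_smul, mul_neg, neg_mul, mul_smul_comm,
      smul_mul_assoc, smul_smul, mul_assoc, e1, e1', e2, e3, e4, e5, e6, e7, e8, e9, e10, e11, e12,
      e13, e14, e15, e16, e17, h.a_mul_v, h.star_a_mul_v, h.star_a_mul_star_v, h.a_mul_star_v,
      h.v_mul_star_v,
      h.star_v_mul_v, h.star_a_mul_c hq, h.star_a_mul_star_c hq, h.a_mul_c, h.a_mul_star_c,
      h.c_mul_star_v, h.c_mul_star_c, star_inv₀, neg_neg, mul_sub, sub_mul, one_mul, mul_one]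
    try match_scalars <;> field_simp
    try ring

end UqRelations

theorem PermutationCondition.sum_eq {E : Fin 3 → Fin 3 → Fin 3 → ℂ} (hE : PermutationCondition E)
    {B : Type*} [AddCommGroup B] [Module ℂ B] (f : Fin 3 → Fin 3 → Fin 3 → B) :
    ∑ i, ∑ j, ∑ k, E i j k • f i j k =
      E 0 1 2 • f 0 1 2 + E 0 2 1 • f 0 2 1 + E 1 0 2 • f 1 0 2 + E 2 0 1 • f 2 0 1 +
        E 1 2 0 • f 1 2 0 + E 2 1 0 • f 2 1 0 := by
  have hz : ∀ i j k, ¬ (i ≠ j ∧ i ≠ k ∧ j ≠ k) → E i j k = 0 := fun i j k hn =>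
    not_not.1 fun hne => hn ((hE i j k).1 hne)
  simp [Fin.sum_univ_three, hz]
  abel

set_option maxHeartbeats 2000000 in
/-- The `2 × 2` block of the fundamental corepresentation of `U_q(2)` together with `v`. -/
theorem UqRelations.woronowiczRelations (h : UqRelations q a c v) (hq : q ≠ 0)
    {E : Fin 3 → Fin 3 → Fin 3 → ℂ} (hE : PermutationCondition E)
    (h1 : E 0 2 1 = -(q * E 0 1 2)) (h2 : E 2 1 0 = -(q * E 1 2 0))
    (h3 : E 2 0 1 = -(star q * E 1 0 2)) :
    WoronowiczRelations E !![v, 0, 0; 0, a, -(q • (star c * star v)); 0, c, star a * star v] := by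
  have h0 : star q ≠ 0 := star_ne_zero.2 hq
  have h0' : (starRingEnd ℂ) q ≠ 0 := star_ne_zero.2 hq
  have e1 : ∀ t, a * (v * t) = v * (a * t) := fun t => by rw [← mul_assoc, h.a_mul_v, mul_assoc]
  have e1' : ∀ t, a * (star v * t) = star v * (a * t) := fun t => by
    rw [← mul_assoc, h.a_mul_star_v, mul_assoc]
  have e2 : ∀ t, star a * (v * t) = v * (star a * t) := fun t => by
    rw [← mul_assoc, h.star_a_mul_v, mul_assoc]
  have e3 : ∀ t, star a * (star v * t) = star v * (star a * t) := fun t => by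
    rw [← mul_assoc, h.star_a_mul_star_v, mul_assoc]
  have e4 : ∀ t, v * (star v * t) = t := fun t => by rw [← mul_assoc, h.v_mul_star_v, one_mul]
  have e5 : ∀ t, star v * (v * t) = t := fun t => by rw [← mul_assoc, h.star_v_mul_v, one_mul]
  have e6 := h.c_mul_v_eq hq
  have e7 := h.c_mul_star_v hq
  have e8 := h.star_c_mul_v hq
  have e9 := h.star_c_mul_star_v hq
  have e10 := fun t => mul_mul_eq_smul_of_mul_eq_smul e6 t
  have e11 := fun t => mul_mul_eq_smul_of_mul_eq_smul e7 t
  have e12 := fun t => mul_mul_eq_smul_of_mul_eq_smul e8 t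
  have e13 := fun t => mul_mul_eq_smul_of_mul_eq_smul e9 t
  have e14 : a * star a = 1 - (q * star q) • (star c * c) := by
    rw [← norm_sq_eq_mul_star, ← h.a_mul_star_a, add_sub_cancel_right]
  have e15 : star a * a = 1 - star c * c := by rw [← h.star_a_mul_a, add_sub_cancel_right]
  have e16 : ∀ t, c * (star c * t) = star c * (c * t) := fun t => by
    rw [← mul_assoc, h.c_mul_star_c, mul_assoc]
  have e17 : ∀ t, a * (star a * t) = t - (q * star q) • (star c * (c * t)) := fun t => by
    rw [← mul_assoc, e14, sub_mul, one_mul, smul_mul_assoc, mul_assoc]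
  have hz : ∀ i j k, ¬ (i ≠ j ∧ i ≠ k ∧ j ≠ k) → E i j k = 0 := fun i j k hn =>
    not_not.1 fun hne => hn ((hE i j k).1 hne)
  constructor
  · intro j k
    fin_cases j <;> fin_cases k <;>
      simp [Fin.sum_univ_three,
        mul_assoc, smul_smul, e1, e1', e2, e3, e4, e5, e6, e7, e8, e9, e10, e11,
        e12, e13, e14, e15, e16, e17, h.a_mul_v, h.star_a_mul_v, h.star_a_mul_star_v,
        h.a_mul_star_v, h.v_mul_star_v, h.star_v_mul_v, h.star_a_mul_star_c hq, h.a_mul_c,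
        h.a_mul_star_c, h.star_a_mul_c hq, h.c_mul_star_c, mul_sub, sub_mul]
    all_goals
      match_scalars <;> ((try field_simp); (try ring))
  · intro j k
    fin_cases j <;> fin_cases k <;>
      simp [Fin.sum_univ_three,
        mul_assoc, smul_smul, e1, e1', e2, e3, e4, e5, e6, e7, e8, e9, e10, e11,
        e12, e13, e14, e15, e16, e17, h.a_mul_v, h.star_a_mul_v, h.star_a_mul_star_v,
        h.a_mul_star_v, h.v_mul_star_v, h.star_v_mul_v, h.star_a_mul_star_c hq, h.a_mul_c,
        h.a_mul_star_c, h.star_a_mul_c hq, h.c_mul_star_c, mul_sub, sub_mul]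
    all_goals
      match_scalars <;> ((try field_simp); (try ring))
  -- All 27 index triples are brought to normal order. With 0 in the middle, `a v a⋆ v⋆ = 1 - |q|²
  -- c⋆ c` has to be balanced by `-q c⋆ c`, which is where `h3` with `star q` is needed.
  · intro i j k
    rw [hE.sum_eq fun i' j' k' => _]
    fin_cases i <;> fin_cases j <;> fin_cases k <;>
    simp only [Fin.isValue, Matrix.of_apply, Matrix.cons_val, Fin.zero_eta, Fin.mk_one,
      Fin.reduceFinMk, mul_zero, zero_mul, smul_zero, add_zero, zero_add, hz, ne_eq, not_true,
      not_false_eq_true, false_and, and_false, and_self, zero_smul]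
    all_goals
      simp [h1, h2, h3, mul_assoc, smul_smul, e1, e1', e2, e3, e4, e5, e6, e7, e8, e9, e10, e11,
        e12, e13, e14, e15, e16, e17, h.a_mul_v, h.star_a_mul_v, h.star_a_mul_star_v,
        h.a_mul_star_v, h.v_mul_star_v, h.star_v_mul_v, h.star_a_mul_star_c hq, h.a_mul_c,
        h.a_mul_star_c, h.star_a_mul_c hq, h.c_mul_star_c, mul_sub, sub_mul]
    all_goals
      match_scalars <;> ((try field_simp); (try ring))

end NormalForm

/-! ### Consequences of the cubic relations for a block matrix -/

namespace WoronowiczRelations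

variable {E : Fin 3 → Fin 3 → Fin 3 → ℂ} {B : Type*}

/-- Relabelling the basis permutes `E` and the matrix simultaneously, so the isolated index may be
taken to be 0. -/
theorem submatrix [Ring B] [StarRing B] [Algebra ℂ B] {w : Matrix (Fin 3) (Fin 3) B}
    (h : WoronowiczRelations E w) (σ : Equiv.Perm (Fin 3)) :
    WoronowiczRelations (fun i j k => E (σ i) (σ j) (σ k)) (w.submatrix σ σ) where
  row j k := by
    simpa using (Equiv.sum_comp σ fun s => w (σ j) s * star (w (σ k) s)).trans (h.row (σ j) (σ k))
  col j k := by
    simpa using (Equiv.sum_comp σ fun s => star (w s (σ j)) * w s (σ k)).trans (h.col (σ j) (σ k))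
  det a b c := by
    rw [← h.det (σ a) (σ b) (σ c), ← Equiv.sum_comp σ fun i => ∑ j, ∑ k,
      E i j k • (w (σ a) i * w (σ b) j * w (σ c) k)]
    refine Finset.sum_congr rfl fun i _ => ?_
    rw [← Equiv.sum_comp σ fun j => ∑ k, E (σ i) j k • (w (σ a) (σ i) * w (σ b) j * w (σ c) k)]
    refine Finset.sum_congr rfl fun j _ => ?_
    exact Equiv.sum_comp σ fun k =>
      E (σ i) (σ j) k • (w (σ a) (σ i) * w (σ b) (σ j) * w (σ c) k)

section Block

variable [Ring B] [StarRing B] [Algebra ℂ B] [StarModule ℂ B] {w : Matrix (Fin 3) (Fin 3) B}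

theorem corner_unitary (h : WoronowiczRelations E w)
    (h0 : ∀ j, j ≠ 0 → w 0 j = 0 ∧ w j 0 = 0) :
    w 0 0 * star (w 0 0) = 1 ∧ star (w 0 0) * w 0 0 = 1 := by
  have z := h0 1 (by decide)
  have z' := h0 2 (by decide)
  exact ⟨by simpa [Fin.sum_univ_three, z, z'] using h.row 0 0,
    by simpa [Fin.sum_univ_three, z, z'] using h.col 0 0⟩

/-- Only the terms with first index 0 survive in the cubic relation at `(0, b, c)`, and its leading
factor `w 0 0` is cancelled by unitarity. -/
theorem det_corner_left (h : WoronowiczRelations E w) (hE : PermutationCondition E)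
    (h0 : ∀ j, j ≠ 0 → w 0 j = 0 ∧ w j 0 = 0) (b c : Fin 3) (hb : b ≠ 0) (hc : c ≠ 0) :
    E 0 1 2 • (w b 1 * w c 2) + E 0 2 1 • (w b 2 * w c 1) = E 0 b c • star (w 0 0) := by
  have h1 := h.det 0 b c
  rw [hE.sum_eq fun i' j' k' => _] at h1
  simp only [(h0 1 (by decide)).1, (h0 2 (by decide)).1, (h0 b hb).2, (h0 c hc).2, mul_zero,
    zero_mul, smul_zero, add_zero] at h1
  linear_combination (norm := (simp only [mul_add, add_mul, mul_sub, sub_mul, mul_smul_comm,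
      mul_neg, neg_mul, smul_mul_assoc, smul_smul, mul_assoc, one_mul, mul_one,
      mul_zero, zero_mul, smul_zero]; module))
    star (w 0 0) * h1 - E 0 1 2 • ((h.corner_unitary h0).2 * w b 1 * w c 2)
      - E 0 2 1 • ((h.corner_unitary h0).2 * w b 2 * w c 1)

theorem det_corner_right (h : WoronowiczRelations E w) (hE : PermutationCondition E)
    (h0 : ∀ j, j ≠ 0 → w 0 j = 0 ∧ w j 0 = 0) (b c : Fin 3) (hb : b ≠ 0) (hc : c ≠ 0) :
    E 1 2 0 • (w b 1 * w c 2) + E 2 1 0 • (w b 2 * w c 1) = E b c 0 • star (w 0 0) := by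
  have h1 := h.det b c 0
  rw [hE.sum_eq fun i' j' k' => _] at h1
  simp only [(h0 1 (by decide)).1, (h0 2 (by decide)).1, (h0 b hb).2, (h0 c hc).2, mul_zero,
    zero_mul, smul_zero, add_zero, zero_add] at h1
  linear_combination (norm := (simp only [mul_add, add_mul, mul_sub, sub_mul, mul_smul_comm,
      mul_neg, neg_mul, smul_mul_assoc, smul_smul, mul_assoc, one_mul, mul_one,
      mul_zero, zero_mul, smul_zero]; module))
    h1 * star (w 0 0) - E 1 2 0 • (w b 1 * w c 2 * (h.corner_unitary h0).1)
      - E 2 1 0 • (w b 2 * w c 1 * (h.corner_unitary h0).1)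

/-- Here `w 0 0` stands between the two block entries, so it cannot be cancelled without first
knowing how it commutes with them. -/
theorem det_corner_middle (h : WoronowiczRelations E w) (hE : PermutationCondition E)
    (h0 : ∀ j, j ≠ 0 → w 0 j = 0 ∧ w j 0 = 0) (b c : Fin 3) (hb : b ≠ 0) (hc : c ≠ 0) :
    E 1 0 2 • (w b 1 * w 0 0 * w c 2) + E 2 0 1 • (w b 2 * w 0 0 * w c 1) = E b 0 c • 1 := by
  have h1 := h.det b 0 c
  rw [hE.sum_eq fun i' j' k' => _] at h1
  simpa only [(h0 1 (by decide)).1, (h0 2 (by decide)).1, (h0 b hb).2, (h0 c hc).2, mul_zero,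
    zero_mul, smul_zero, add_zero, zero_add] using h1

/-- If the first and the third leg of `E` have the same ratios, then the `2 × 2` block satisfies
the relations of `U_q(2)`. -/
theorem uqRelations (h : WoronowiczRelations E w) (hE : PermutationCondition E)
    (h0 : ∀ j, j ≠ 0 → w 0 j = 0 ∧ w j 0 = 0) :
    UqRelations (-(E 0 2 1 / E 0 1 2)) (w 1 1) (w 2 1) (w 0 0) ∧
      w 1 2 = -((-(E 0 2 1 / E 0 1 2)) • (star (w 2 1) * star (w 0 0))) ∧
      w 2 2 = star (w 1 1) * star (w 0 0) := by
  have hz : ∀ i j k, ¬ (i ≠ j ∧ i ≠ k ∧ j ≠ k) → E i j k = 0 := fun i j k hn =>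
    not_not.1 fun hne => hn ((hE i j k).1 hne)
  have n1 : E 0 1 2 ≠ 0 := (hE 0 1 2).2 (by decide)
  have n2 : E 0 2 1 ≠ 0 := (hE 0 2 1).2 (by decide)
  have z := h0 1 (by decide)
  have z' := h0 2 (by decide)
  have c := h.col
  have c11 := c 1 1
  have c12 := c 1 2
  have c21 := c 2 1
  have c22 := c 2 2
  simp [Fin.sum_univ_three, z, z'] at c11 c12 c21 c22
  -- Dividing by `E 0 1 2` normalises the determinant relation to the coefficients `1` and `-q`.
  -- Only the relations with 0 in first place are used.
  have d := fun b c hb hc => congrArg ((E 0 1 2)⁻¹ • ·) (h.det_corner_left hE h0 b c hb hc)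
  simp only [smul_add, smul_smul, inv_mul_cancel₀ n1, one_smul] at d
  have hq : -(E 0 2 1 / E 0 1 2) = -((E 0 1 2)⁻¹ * E 0 2 1) := by rw [div_eq_inv_mul]
  refine uqRelations_of_unitary (neg_ne_zero.2 (div_ne_zero n2 n1)) (h.corner_unitary h0).1
    (h.corner_unitary h0).2 c11 c12 c21 c22 ?_ ?_ ?_ ?_
  · have := d 1 1 (by decide) (by decide)
    rw [hz 0 1 1 (by decide), mul_zero, zero_smul] at this
    rw [hq, neg_smul, sub_neg_eq_add, this]
  · have := d 1 2 (by decide) (by decide)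
    rw [inv_mul_cancel₀ n1, one_smul] at this
    rw [hq, neg_smul, sub_neg_eq_add, this]
  · have := d 2 1 (by decide) (by decide)
    rw [hq, neg_smul, neg_smul, sub_neg_eq_add, this, neg_neg]
  · have := d 2 2 (by decide) (by decide)
    rw [hz 0 2 2 (by decide), mul_zero, zero_smul] at this
    rw [hq, neg_smul, sub_neg_eq_add, this]

end Block

section CStar

variable [CStarAlgebra B] {w : Matrix (Fin 3) (Fin 3) B}

/-- If the ratios of the three legs of `E` are not compatible, then the block is diagonal. -/
theorem diagonal_of_not_compatible (h : WoronowiczRelations E w) (hE : PermutationCondition E)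
    (h0 : ∀ j, j ≠ 0 → w 0 j = 0 ∧ w j 0 = 0)
    (hcond : ¬ (E 0 1 2 / E 0 2 1 = E 1 2 0 / E 2 1 0 ∧
      E 0 1 2 / E 0 2 1 = star (E 1 0 2) / star (E 2 0 1))) : w 1 2 = 0 ∧ w 2 1 = 0 := by
  have hz : ∀ i j k, ¬ (i ≠ j ∧ i ≠ k ∧ j ≠ k) → E i j k = 0 := fun i j k hn =>
    not_not.1 fun hne => hn ((hE i j k).1 hne)
  have n1 : E 0 1 2 ≠ 0 := (hE 0 1 2).2 (by decide)
  have n2 : E 0 2 1 ≠ 0 := (hE 0 2 1).2 (by decide)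
  have n3 : E 1 2 0 ≠ 0 := (hE 1 2 0).2 (by decide)
  have n4 : E 2 1 0 ≠ 0 := (hE 2 1 0).2 (by decide)
  have n5 : E 1 0 2 ≠ 0 := (hE 1 0 2).2 (by decide)
  have n6 : E 2 0 1 ≠ 0 := (hE 2 0 1).2 (by decide)
  obtain ⟨hv1, hv2⟩ := h.corner_unitary h0
  by_cases hps : E 0 1 2 / E 0 2 1 = E 1 2 0 / E 2 1 0
  -- The outer ratios agree, so the middle one is wrong. The relations of `U_q(2)` turn the middle
  -- relation at `(1, 2)` into a scalar multiple of `c⋆ c`, and that scalar vanishes only if the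
  -- middle ratio is right.
  · have hm : E 0 1 2 / E 0 2 1 ≠ star (E 1 0 2) / star (E 2 0 1) := fun hm => hcond ⟨hps, hm⟩
    obtain ⟨hu, hβ, hδ⟩ := h.uqRelations hE h0
    have d := h.det_corner_middle hE h0 1 2 (by decide) (by decide)
    set q : ℂ := -(E 0 2 1 / E 0 1 2) with hqdef
    have hq : q ≠ 0 := neg_ne_zero.2 (div_ne_zero n2 n1)
    rw [hβ, hδ] at d
    have hcc : (E 1 0 2 * q * star q + E 2 0 1 * q) • (star (w 2 1) * w 2 1) = 0 := by
      have e1 : w 1 1 * w 0 0 * (star (w 1 1) * star (w 0 0)) =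
          1 - (q * star q) • (star (w 2 1) * w 2 1) := by
        rw [hu.star_a_mul_star_v, mul_assoc, ← mul_assoc (w 0 0), hv1,
          one_mul, ← norm_sq_eq_mul_star, ← hu.a_mul_star_a, add_sub_cancel_right]
      have e2 : -(q • (star (w 2 1) * star (w 0 0))) * w 0 0 * w 2 1 =
          -(q • (star (w 2 1) * w 2 1)) := by
        rw [neg_mul, neg_mul, smul_mul_assoc, smul_mul_assoc, mul_assoc (star (w 2 1)), hv2,
          mul_one]
      rw [e1, e2] at d
      linear_combination (norm := module) -d
    have hne : E 1 0 2 * q * star q + E 2 0 1 * q ≠ 0 := by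
      intro h1
      apply hm
      have h2 : E 1 0 2 * star q = - E 2 0 1 := by
        refine mul_left_cancel₀ hq ?_
        linear_combination h1
      have h3 : star (E 1 0 2) * q = - star (E 2 0 1) := by
        simpa using congrArg star h2
      have n7 : star (E 2 0 1) ≠ 0 := star_ne_zero.2 n6
      rw [hqdef] at h3
      field_simp at h3 ⊢
      linear_combination h3
    have hc : w 2 1 = 0 :=
      (CStarRing.star_mul_self_eq_zero_iff _).1 ((smul_eq_zero.1 hcc).resolve_left hne)
    refine ⟨by rw [hβ, hc]; simp, hc⟩
  · have l := h.det_corner_left hE h0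
    have r := h.det_corner_right hE h0
    -- The determinant of the linear system formed by the first-place and last-place relations, with
    -- unknowns `w b 1 * w c 2` and `w b 2 * w c 1`. `key` is Cramer's rule.
    have hne : E 0 1 2 * E 2 1 0 - E 0 2 1 * E 1 2 0 ≠ 0 := by
      intro h1
      apply hps
      field_simp
      linear_combination h1
    have key : ∀ b c, b ≠ 0 → c ≠ 0 →
        (E 0 1 2 * E 2 1 0 - E 0 2 1 * E 1 2 0) • (w b 1 * w c 2) =
          (E 2 1 0 * E 0 b c - E 0 2 1 * E b c 0) • star (w 0 0) ∧
        (E 0 1 2 * E 2 1 0 - E 0 2 1 * E 1 2 0) • (w b 2 * w c 1) =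
          (E 0 1 2 * E b c 0 - E 1 2 0 * E 0 b c) • star (w 0 0) := fun b c hb hc =>
      ⟨by linear_combination (norm := module) E 2 1 0 • l b c hb hc - E 0 2 1 • r b c hb hc,
        by linear_combination (norm := module) E 0 1 2 • r b c hb hc - E 1 2 0 • l b c hb hc⟩
    have k11 := key 1 1 (by decide) (by decide)
    have k22 := key 2 2 (by decide) (by decide)
    have k12 := key 1 2 (by decide) (by decide)
    have k21 := key 2 1 (by decide) (by decide)
    rw [hz 0 1 1 (by decide), hz 1 1 0 (by decide)] at k11
    rw [hz 0 2 2 (by decide), hz 2 2 0 (by decide)] at k22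
    simp only [mul_zero, sub_zero, zero_smul, smul_eq_zero, hne, false_or] at k11 k22
    have a1 : w 1 1 * w 2 2 = star (w 0 0) := smul_right_injective B hne (by
      linear_combination (norm := module) k12.1)
    have a2 : w 2 2 * w 1 1 = star (w 0 0) := smul_right_injective B hne (by
      linear_combination (norm := module) k21.2)
    constructor
    -- The unitary `star (w 0 0)` is the product of the diagonal entries in either order, while
    -- products of two entries in the same row vanish. Hence it annihilates the off-diagonal
    -- entries.
    · have : star (w 0 0) * w 1 2 = 0 := by rw [← a2, mul_assoc, k11.1, mul_zero]
      rw [← one_mul (w 1 2), ← hv1, mul_assoc, this, mul_zero]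
    · have : star (w 0 0) * w 2 1 = 0 := by rw [← a1, mul_assoc, k22.2, mul_zero]
      rw [← one_mul (w 2 1), ← hv1, mul_assoc, this, mul_zero]

/-- The entries of a diagonal solution of the relations. -/
theorem diagonal_entries (h : WoronowiczRelations E w) (hE : PermutationCondition E)
    (h0 : ∀ j, j ≠ 0 → w 0 j = 0 ∧ w j 0 = 0) (h12 : w 1 2 = 0) (h21 : w 2 1 = 0) :
    w 1 1 ∈ unitary B ∧ w 2 2 ∈ unitary B ∧ Commute (w 1 1) (w 2 2) ∧
      w 0 0 = star (w 1 1 * w 2 2) := by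
  have n1 : E 0 1 2 ≠ 0 := (hE 0 1 2).2 (by decide)
  have n2 : E 0 2 1 ≠ 0 := (hE 0 2 1).2 (by decide)
  have z := h0 1 (by decide)
  have z' := h0 2 (by decide)
  have e1 := h.det_corner_left hE h0 1 2 (by decide) (by decide)
  have e2 := h.det_corner_left hE h0 2 1 (by decide) (by decide)
  rw [h12, h21, mul_zero, smul_zero, add_zero] at e1
  rw [h12, h21, mul_zero, smul_zero, zero_add] at e2
  have e1 := smul_right_injective B n1 e1
  have e2 := smul_right_injective B n2 e2
  refine ⟨Unitary.mem_iff.2 ⟨?_, ?_⟩, Unitary.mem_iff.2 ⟨?_, ?_⟩, e1.trans e2.symm, ?_⟩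
  · simpa [Fin.sum_univ_three, z, z', h12, h21] using h.col 1 1
  · simpa [Fin.sum_univ_three, z, z', h12, h21] using h.row 1 1
  · simpa [Fin.sum_univ_three, z, z', h12, h21] using h.col 2 2
  · simpa [Fin.sum_univ_three, z, z', h12, h21] using h.row 2 2
  · rw [e1, star_star]

end CStar

end WoronowiczRelations

/-! ### Universal C⋆-algebras and comultiplications -/

theorem StarAlgHom.continuous_of_cstar {A B : Type*} [CStarAlgebra A] [CStarAlgebra B]
    (f : A →⋆ₐ[ℂ] B) : Continuous f :=
  AddMonoidHomClass.continuous_of_bound f 1 fun x => by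
    simpa using NonUnitalStarAlgHom.norm_apply_le f x

theorem CStarSeminorm.hom_ext {F : Type} [Ring F] [StarRing F] [Algebra ℂ F] [StarModule ℂ F]
    {p : CStarSeminorm F} {B : Type*} [CStarAlgebra B] {f g : p.Completion →⋆ₐ[ℂ] B}
    (h : ∀ x, f (p.of x) = g (p.of x)) : f = g := by
  ext x
  exact p.induction x (isClosed_eq f.continuous_of_cstar g.continuous_of_cstar) h

theorem FreeStarAlgebra.hom_ext {X : Type} {B : Type*} [Ring B] [StarRing B] [Algebra ℂ B]
    {f g : FreeStarAlgebra X →⋆ₐ[ℂ] B} (h : ∀ x, f (gen x) = g (gen x)) : f = g := by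
  ext x
  induction x using FreeStarAlgebra.induction with
  | h1 c => rw [AlgHomClass.commutes, AlgHomClass.commutes]
  | h2 x =>
    cases x with
    | inl x => exact h x
    | inr x =>
      rw [show letter (Sum.inr x) = star (gen x) from (star_letter (Sum.inl x)).symm, map_star,
        map_star, h]
  | h3 x y hx hy => rw [map_mul, map_mul, hx, hy]
  | h4 x y hx hy => rw [map_add, map_add, hx, hy]

theorem UniversalCStar.hom_ext {X : Type} {R : Set (FreeStarAlgebra X)} {B : Type*}
    [CStarAlgebra B] {f g : UniversalCStar R →⋆ₐ[ℂ] B}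
    (h : ∀ x, f (UniversalCStar.gen R x) = g (UniversalCStar.gen R x)) : f = g :=
  CStarSeminorm.hom_ext fun x => DFunLike.congr_fun (FreeStarAlgebra.hom_ext
    (f := f.comp (universalSeminorm R).of) (g := g.comp (universalSeminorm R).of) h) x

namespace WoronowiczRelations

variable {E : Fin 3 → Fin 3 → Fin 3 → ℂ} {B : Type*} [Ring B] [StarRing B] [Algebra ℂ B]

theorem map {B' : Type*} [Ring B'] [StarRing B'] [Algebra ℂ B'] {w : Matrix (Fin 3) (Fin 3) B}
    (h : WoronowiczRelations E w) (φ : B →⋆ₐ[ℂ] B') : WoronowiczRelations E (w.map φ) where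
  row j k := by
    have := congrArg φ (h.row j k)
    simpa only [map_sum, map_mul, map_star, apply_ite φ, map_one, map_zero, Matrix.map_apply]
      using this
  col j k := by
    have := congrArg φ (h.col j k)
    simpa only [map_sum, map_mul, map_star, apply_ite φ, map_one, map_zero, Matrix.map_apply]
      using this
  det a b c := by
    have := congrArg φ (h.det a b c)
    simpa only [map_sum, map_mul, map_smul, map_one, Matrix.map_apply] using this

/-- The determinant relation says that `E` is fixed by the third tensor power of the matrix. When
the entries of `x` commute with those of `y`, the third power of `x * y` factors as that of `x`
times that of `y`, so `E` stays fixed. -/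
theorem mul {x y : Matrix (Fin 3) (Fin 3) B} (hx : WoronowiczRelations E x)
    (hy : WoronowiczRelations E y) (hxy : ∀ i j k l, Commute (x i j) (y k l)) :
    WoronowiczRelations E (x * y) where
  row j k := by
    have h1 : x * x.conjTranspose = 1 := by
      ext j k
      exact (hx.row j k).trans Matrix.one_apply.symm
    have h2 : y * y.conjTranspose = 1 := by
      ext j k
      exact (hy.row j k).trans Matrix.one_apply.symm
    have h3 : (x * y) * (x * y).conjTranspose = 1 := by
      rw [Matrix.conjTranspose_mul, Matrix.mul_assoc, ← Matrix.mul_assoc y, h2, Matrix.one_mul, h1]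
    exact (congrFun (congrFun h3 j) k).trans Matrix.one_apply
  col j k := by
    have h1 : x.conjTranspose * x = 1 := by
      ext j k
      exact (hx.col j k).trans Matrix.one_apply.symm
    have h2 : y.conjTranspose * y = 1 := by
      ext j k
      exact (hy.col j k).trans Matrix.one_apply.symm
    have h3 : (x * y).conjTranspose * (x * y) = 1 := by
      rw [Matrix.conjTranspose_mul, Matrix.mul_assoc, ← Matrix.mul_assoc _ x, h1, Matrix.one_mul,
        h2]
    exact (congrFun (congrFun h3 j) k).trans Matrix.one_apply
  det a b c := by
    have e1 : ∀ i j k, (x * y) a i * (x * y) b j * (x * y) c k =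
        ∑ l, ∑ m, ∑ n, x a l * x b m * x c n * (y l i * y m j * y n k) := by
      intro i j k
      rw [Matrix.mul_apply, Matrix.mul_apply, Matrix.mul_apply, Finset.sum_mul_sum]
      simp only [Finset.sum_mul]
      simp only [Finset.mul_sum]
      refine Finset.sum_congr rfl fun l _ => Finset.sum_congr rfl fun m _ =>
        Finset.sum_congr rfl fun n _ => ?_
      have h1 := (hxy b m l i).eq
      have h2 := (hxy c n m j).eq
      have h3 := (hxy c n l i).eq
      calc x a l * y l i * (x b m * y m j) * (x c n * y n k)
          = x a l * (y l i * x b m) * (y m j * x c n) * y n k := by noncomm_ring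
        _ = x a l * x b m * (y l i * x c n) * y m j * y n k := by rw [← h1, ← h2]; noncomm_ring
        _ = x a l * x b m * x c n * (y l i * y m j * y n k) := by rw [← h3]; noncomm_ring
    calc ∑ i, ∑ j, ∑ k, E i j k • ((x * y) a i * (x * y) b j * (x * y) c k)
        = ∑ l, ∑ m, ∑ n, x a l * x b m * x c n *
            ∑ i, ∑ j, ∑ k, E i j k • (y l i * y m j * y n k) := by
          simp only [e1, Finset.smul_sum, Finset.mul_sum, mul_smul_comm]
          -- Summing over triples allows the two threefold sums to be exchanged in one step.
          have h := Finset.sum_comm (s := Finset.univ (α := Fin 3 × Fin 3 × Fin 3))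
            (t := Finset.univ (α := Fin 3 × Fin 3 × Fin 3)) (f := fun p r =>
              E p.1 p.2.1 p.2.2 • (x a r.1 * x b r.2.1 * x c r.2.2 *
                (y r.1 p.1 * y r.2.1 p.2.1 * y r.2.2 p.2.2)))
          simpa only [Fintype.sum_prod_type] using h
      _ = ∑ l, ∑ m, ∑ n, E l m n • (x a l * x b m * x c n) := by
          simp only [hy.det, mul_smul_comm, mul_one]
      _ = E a b c • 1 := hx.det a b c

end WoronowiczRelations

theorem woronowiczRelations_woronowiczMatrix (E : Fin 3 → Fin 3 → Fin 3 → ℂ) :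
    WoronowiczRelations E (woronowiczMatrix E) where
  row j k := by
    have h := UniversalCStar.of_eq_zero (R := woronowiczRelators E) (Or.inl (Or.inl ⟨j, k, rfl⟩))
    simp only [map_sub, map_sum, map_mul, map_star, apply_ite (universalSeminorm _).of, map_one,
      map_zero, sub_eq_zero] at h
    exact h
  col j k := by
    have h := UniversalCStar.of_eq_zero (R := woronowiczRelators E) (Or.inl (Or.inr ⟨j, k, rfl⟩))
    simp only [map_sub, map_sum, map_mul, map_star, apply_ite (universalSeminorm _).of, map_one,
      map_zero, sub_eq_zero] at h
    exact h
  det a b c := by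
    have h := UniversalCStar.of_eq_zero (R := woronowiczRelators E) (Or.inr ⟨a, b, c, rfl⟩)
    simp only [map_sub, map_sum, map_mul, map_smul, map_one, sub_eq_zero] at h
    exact h

theorem WoronowiczRelations.exists_hom {E : Fin 3 → Fin 3 → Fin 3 → ℂ} {B : Type*} [CStarAlgebra B]
    {w : Matrix (Fin 3) (Fin 3) B} (h : WoronowiczRelations E w) :
    ∃ φ : WoronowiczAlgebra E →⋆ₐ[ℂ] B, ∀ i j, φ (woronowiczMatrix E i j) = w i j :=
  WoronowiczAlgebra.exists_hom w h.row h.col h.det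

/-! ### Comultiplication of the Woronowicz construction -/

section MinTensor

variable {A B : Type} [CStarAlgebra A] [CStarAlgebra B]

variable (A B) in
/-- The embedding `a ↦ a ⊗ 1`. -/
def minTensorLeft : A →⋆ₐ[ℂ] MinTensor A B :=
  { ((minSeminorm A B).of : A ⊗[ℂ] B →ₐ[ℂ] MinTensor A B).comp
      (Algebra.TensorProduct.includeLeft : A →ₐ[ℂ] A ⊗[ℂ] B) with
    map_star' := fun a => by
      change (minSeminorm A B).of (star a ⊗ₜ 1) = star ((minSeminorm A B).of (a ⊗ₜ 1))
      rw [← map_star, TensorProduct.star_tmul, star_one] }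

variable (A B) in
/-- The embedding `b ↦ 1 ⊗ b`. -/
def minTensorRight : B →⋆ₐ[ℂ] MinTensor A B :=
  { ((minSeminorm A B).of : A ⊗[ℂ] B →ₐ[ℂ] MinTensor A B).comp
      (Algebra.TensorProduct.includeRight : B →ₐ[ℂ] A ⊗[ℂ] B) with
    map_star' := fun b => by
      change (minSeminorm A B).of (1 ⊗ₜ star b) = star ((minSeminorm A B).of (1 ⊗ₜ b))
      rw [← map_star, TensorProduct.star_tmul, star_one] }

theorem minTensorLeft_mul_right (a : A) (b : B) :
    minTensorLeft A B a * minTensorRight A B b = minTmul a b := by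
  change (minSeminorm A B).of (a ⊗ₜ 1) * (minSeminorm A B).of (1 ⊗ₜ b) = _
  rw [← map_mul, Algebra.TensorProduct.tmul_mul_tmul, one_mul, mul_one]
  rfl

theorem minTensorRight_mul_left (a : A) (b : B) :
    minTensorRight A B b * minTensorLeft A B a = minTmul a b := by
  change (minSeminorm A B).of (1 ⊗ₜ b) * (minSeminorm A B).of (a ⊗ₜ 1) = _
  rw [← map_mul, Algebra.TensorProduct.tmul_mul_tmul, one_mul, mul_one]
  rfl

end MinTensor

/-- The matrices `u ⊗ 1` and `1 ⊗ u` satisfy the relations and their entries commute, so their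
product is again a solution and the universal property applies. -/
theorem exists_comultiplication (E : Fin 3 → Fin 3 → Fin 3 → ℂ) :
    ∃ Δ : WoronowiczAlgebra E →⋆ₐ[ℂ] MinTensor (WoronowiczAlgebra E) (WoronowiczAlgebra E),
      IsComultiplication (woronowiczMatrix E) Δ := by
  have h := woronowiczRelations_woronowiczMatrix E
  obtain ⟨Δ, hΔ⟩ := ((h.map (minTensorLeft _ (WoronowiczAlgebra E))).mul
    (h.map (minTensorRight (WoronowiczAlgebra E) _)) fun i j k l =>
      (minTensorLeft_mul_right _ _).trans (minTensorRight_mul_left _ _).symm).exists_hom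
  refine ⟨Δ, fun i j => (hΔ i j).trans ?_⟩
  rw [Matrix.mul_apply]
  exact Finset.sum_congr rfl fun k _ => minTensorLeft_mul_right _ _

/-- A comultiplication can be transported along an isomorphism of C⋆-algebras. -/
theorem QuantumGroupIso.of_starAlgEquiv {ι κ A B : Type} [Fintype ι] [Fintype κ] [CStarAlgebra A]
    [CStarAlgebra B] {u : Matrix ι ι A} {w : Matrix κ κ B} {Δ : A →⋆ₐ[ℂ] MinTensor A A}
    (hΔ : IsComultiplication u Δ) (Φ : A ≃⋆ₐ[ℂ] B)
    (hw : ∀ i j, minTensorMap (Φ : A →⋆ₐ[ℂ] B) (Φ : A →⋆ₐ[ℂ] B) (Δ (Φ.symm (w i j))) =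
      ∑ k, minTmul (w i k) (w k j)) : QuantumGroupIso u w := by
  refine ⟨Δ, ((minTensorMap (Φ : A →⋆ₐ[ℂ] B) (Φ : A →⋆ₐ[ℂ] B)).comp Δ).comp
    (Φ.symm : B →⋆ₐ[ℂ] A), hΔ, hw, Φ, fun x => ?_⟩
  change minTensorMap _ _ (Δ (Φ.symm (Φ x))) = _
  rw [StarAlgEquiv.symm_apply_apply]

theorem QuantumGroupIso.of_permutation {ι κ A B : Type} [Fintype ι] [Fintype κ] [CStarAlgebra A]
    [CStarAlgebra B] {u : Matrix ι ι A} {w : Matrix κ κ B} {Δ : A →⋆ₐ[ℂ] MinTensor A A}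
    (hΔ : IsComultiplication u Δ) (Φ : A ≃⋆ₐ[ℂ] B) (σ : κ ≃ ι)
    (hw : ∀ i j, Φ (u (σ i) (σ j)) = w i j) : QuantumGroupIso u w := by
  refine of_starAlgEquiv hΔ Φ fun i j => ?_
  rw [← hw, StarAlgEquiv.symm_apply_apply, hΔ, map_sum, ← Equiv.sum_comp σ]
  refine Finset.sum_congr rfl fun k _ => ?_
  rw [minTensorMap_minTmul, ← hw, ← hw]
  rfl

/-! ### The algebra of `U_q(2)` -/

open FreeStarAlgebra in
theorem uqRelations_of_forall_eq_zero {q : ℂ} {B : Type*} [Ring B] [StarRing B] [Algebra ℂ B]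
    (f : FreeStarAlgebra UqGenerator →⋆ₐ[ℂ] B) (h : ∀ r ∈ uqRelators q, f r = 0) :
    UqRelations q (f (gen .a)) (f (gen .c)) (f (gen .v)) := by
  simp only [uqRelators, Set.mem_insert_iff, Set.mem_singleton_iff, forall_eq_or_imp, forall_eq,
    map_sub, map_add, map_mul, map_smul, map_star, map_one, sub_eq_zero] at h
  obtain ⟨h1, h2, h3, h4, h5, h6, h7, h8, h9⟩ := h
  exact ⟨h1, h2, h3, h4, h5, h6, h7, h8, h9⟩

theorem uqRelations_gen (q : ℂ) :
    UqRelations q (UniversalCStar.gen (uqRelators q) .a) (UniversalCStar.gen (uqRelators q) .c)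
      (UniversalCStar.gen (uqRelators q) .v) :=
  uqRelations_of_forall_eq_zero (universalSeminorm (uqRelators q)).of
    fun _ hr => UniversalCStar.of_eq_zero hr

theorem UqRelations.exists_hom {q : ℂ} {B : Type*} [CStarAlgebra B] {a c v : B}
    (h : UqRelations q a c v) :
    ∃ φ : UqAlgebra q →⋆ₐ[ℂ] B, φ (UniversalCStar.gen (uqRelators q) .a) = a ∧
      φ (UniversalCStar.gen (uqRelators q) .c) = c ∧
      φ (UniversalCStar.gen (uqRelators q) .v) = v := by
  obtain ⟨φ, hφ⟩ := UqAlgebra.exists_hom (q := q) (B := B)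
    (fun | .a => a | .c => c | .v => v) (by
      simp only [uqRelators, Set.mem_insert_iff, Set.mem_singleton_iff, forall_eq_or_imp,
        forall_eq, map_sub, map_add, map_mul, map_smul, map_star, map_one, sub_eq_zero,
        FreeStarAlgebra.eval_gen]
      exact ⟨h.1, h.2, h.3, h.4, h.5, h.6, h.7, h.8, h.9⟩)
  exact ⟨φ, hφ .a, hφ .c, hφ .v⟩

/-- If the ratios of the three legs of `E` are compatible, then the quantum group is `U_q(2)`. -/
theorem quantumGroupIso_uqMatrix {E : Fin 3 → Fin 3 → Fin 3 → ℂ} (hE : PermutationCondition E)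
    (σ : Equiv.Perm (Fin 3))
    (h0 : ∀ j, j ≠ σ 0 → woronowiczMatrix E (σ 0) j = 0 ∧ woronowiczMatrix E j (σ 0) = 0) {q : ℂ}
    (hq : q ≠ 0) (h1 : E (σ 0) (σ 2) (σ 1) = -(q * E (σ 0) (σ 1) (σ 2)))
    (h2 : E (σ 2) (σ 1) (σ 0) = -(q * E (σ 1) (σ 2) (σ 0)))
    (h3 : E (σ 2) (σ 0) (σ 1) = -(star q * E (σ 1) (σ 0) (σ 2))) :
    QuantumGroupIso (woronowiczMatrix E) (uqMatrix q) := by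
  have hE' : PermutationCondition fun i j k => E (σ i) (σ j) (σ k) := fun i j k => by
    simp only [hE _ _ _, ne_eq, EmbeddingLike.apply_eq_iff_eq]
  have n1 : E (σ 0) (σ 1) (σ 2) ≠ 0 := (hE' 0 1 2).2 (by decide)
  have hrel : WoronowiczRelations E ((uqMatrix q).submatrix σ.symm σ.symm) := by
    have h := ((uqRelations_gen q).woronowiczRelations hq hE' h1 h2 h3).submatrix σ.symm
    simp only [Equiv.apply_symm_apply] at h
    exact h
  obtain ⟨φ, hφ⟩ := hrel.exists_hom
  have hblock := ((woronowiczRelations_woronowiczMatrix E).submatrix σ).uqRelations hE'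
    fun j hj => h0 (σ j) (σ.injective.ne hj)
  -- The parameter that the block of `u` produces is the prescribed `q`, so both universal
  -- properties concern the same algebra.
  have hqE : -(E (σ 0) (σ 2) (σ 1) / E (σ 0) (σ 1) (σ 2)) = q := by
    rw [h1]
    field_simp
  rw [hqE] at hblock
  obtain ⟨hu, hβ, hδ⟩ := hblock
  obtain ⟨ψ, ha, hc, hv⟩ := hu.exists_hom
  have hψ : ∀ i j, ψ (uqMatrix q i j) = woronowiczMatrix E (σ i) (σ j) := by
    have z1 := h0 (σ 1) (σ.injective.ne (by decide))
    have z2 := h0 (σ 2) (σ.injective.ne (by decide))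
    intro i j
    fin_cases i <;> fin_cases j <;>
      simp [uqMatrix, ha, hc, hv, z1, z2, map_star] 
    · exact hβ.symm
    · exact hδ.symm
  have hψφ : ψ.comp φ = StarAlgHom.id ℂ _ := UniversalCStar.hom_ext fun x => by
    change ψ (φ (woronowiczMatrix E x.1 x.2)) = woronowiczMatrix E x.1 x.2
    rw [hφ, Matrix.submatrix_apply, hψ, Equiv.apply_symm_apply, Equiv.apply_symm_apply]
  have hφu : ∀ i j, φ (woronowiczMatrix E (σ i) (σ j)) = uqMatrix q i j := fun i j => by
    rw [hφ, Matrix.submatrix_apply, Equiv.symm_apply_apply, Equiv.symm_apply_apply]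
  have hφψ : φ.comp ψ = StarAlgHom.id ℂ _ := UniversalCStar.hom_ext fun x => by
    cases x with
    | a => exact (congrArg φ (hψ 1 1)).trans (hφu 1 1)
    | c => exact (congrArg φ (hψ 2 1)).trans (hφu 2 1)
    | v => exact (congrArg φ (hψ 0 0)).trans (hφu 0 0)
  obtain ⟨Δ, hΔ⟩ := exists_comultiplication E
  exact QuantumGroupIso.of_permutation hΔ (StarAlgEquiv.ofStarAlgHom φ ψ hψφ hφψ) σ hφu

/-! ### The diagonal case -/

/-- The ⋆-polynomials in the generators are dense, and multiplication is continuous. -/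
theorem UniversalCStar.commute_of_gen {X : Type} {R : Set (FreeStarAlgebra X)}
    (h1 : ∀ x y, Commute (UniversalCStar.gen R x) (UniversalCStar.gen R y))
    (h2 : ∀ x y, Commute (UniversalCStar.gen R x) (star (UniversalCStar.gen R y)))
    (s t : UniversalCStar R) : Commute s t := by
  have hinr : ∀ x, (universalSeminorm R).of (FreeStarAlgebra.letter (Sum.inr x)) =
      star (UniversalCStar.gen R x) := fun x => by
    rw [show FreeStarAlgebra.letter (Sum.inr x) = star (FreeStarAlgebra.gen x) from
      (FreeStarAlgebra.star_letter (Sum.inl x)).symm, map_star]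
    rfl
  have hl : ∀ x y, Commute ((universalSeminorm R).of (FreeStarAlgebra.letter x))
      ((universalSeminorm R).of (FreeStarAlgebra.letter y)) := by
    rintro (x | x) (y | y)
    · exact h1 x y
    · rw [hinr]
      exact h2 x y
    · rw [hinr]
      exact (h2 y x).symm
    · rw [hinr, hinr]
      exact (h1 x y).star_star
  refine CStarSeminorm.induction _ s (isClosed_eq (continuous_id.mul continuous_const)
    (continuous_const.mul continuous_id)) fun s => ?_
  refine CStarSeminorm.induction _ t (isClosed_eq (continuous_const.mul continuous_id)
    (continuous_id.mul continuous_const)) fun t => ?_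
  change Commute ((universalSeminorm R).of s) ((universalSeminorm R).of t)
  induction s using FreeStarAlgebra.induction with
  | h1 c => rw [AlgHomClass.commutes]; exact Algebra.commutes c _
  | h3 x y hx hy => rw [map_mul]; exact hx.mul_left hy
  | h4 x y hx hy => rw [map_add]; exact hx.add_left hy
  | h2 x =>
    induction t using FreeStarAlgebra.induction with
    | h1 c => rw [AlgHomClass.commutes]; exact (Algebra.commutes c _).symm
    | h3 y z hy hz => rw [map_mul]; exact hy.mul_right hz
    | h4 y z hy hz => rw [map_add]; exact hy.add_right hz
    | h2 y => exact hl x y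

theorem Commute.star_right_of_unitary {B : Type*} [Ring B] [StarRing B] {x y : B}
    (h : Commute x y) (hy : y ∈ unitary B) : Commute x (star y) := by
  have h1 := Unitary.star_mul_self_of_mem hy
  have h2 := Unitary.mul_star_self_of_mem hy
  calc x * star y = star y * (y * x) * star y := by rw [← mul_assoc, h1, one_mul]
    _ = star y * x := by rw [← h.eq, mul_assoc, mul_assoc, h2, mul_one]

/-- For a commuting diagonal matrix every nonzero coefficient of `E` is multiplied by the product of
all three entries. Hence product one is enough, whatever the values of `E`. -/
theorem woronowiczRelations_diagonal {E : Fin 3 → Fin 3 → Fin 3 → ℂ} (hE : PermutationCondition E)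
    {B : Type*} [CommRing B] [StarRing B] [Algebra ℂ B] {d : Fin 3 → B}
    (hd : ∀ i, d i * star (d i) = 1) (hprod : d 0 * d 1 * d 2 = 1) :
    WoronowiczRelations E (Matrix.diagonal d) where
  row j k := by
    by_cases h : j = k
    · subst h
      simp [Matrix.diagonal_apply, hd]
    · simp [Matrix.diagonal_apply, h, Ne.symm h]
  col j k := by
    by_cases h : j = k
    · subst h
      simp [Matrix.diagonal_apply, apply_ite star, mul_comm, hd]
    · simp [Matrix.diagonal_apply, apply_ite star, h, Ne.symm h]
  det a b c := by
    by_cases h : E a b c = 0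
    · simp [Matrix.diagonal_apply, h]
    · obtain ⟨h1, h2, h3⟩ := (hE a b c).1 h
      have : d a * d b * d c = 1 := by
        rw [← hprod]
        fin_cases a <;> fin_cases b <;> fin_cases c <;> simp at h1 h2 h3 ⊢ <;> ring
      simp [Matrix.diagonal_apply, this]

/-- A unital C⋆-algebra generated by two commuting unitaries. -/
theorem bijective_of_commuting_unitaries {X : Type} {R : Set (FreeStarAlgebra X)}
    (hcomm : ∀ s t : UniversalCStar R, s * t = t * s) {x y : UniversalCStar R}
    (hx : x ∈ unitary (UniversalCStar R)) (hy : y ∈ unitary (UniversalCStar R))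
    (hgen : ∀ {B : Type} [CStarAlgebra B] (f g : UniversalCStar R →⋆ₐ[ℂ] B),
      f x = g x → f y = g y → f = g)
    (φ : UniversalCStar R →⋆ₐ[ℂ] C(Circle × Circle, ℂ)) (hφx : ∀ z, φ x z = z.1)
    (hφy : ∀ z, φ y z = z.2) : Function.Bijective φ := by
  let _ : CommCStarAlgebra (UniversalCStar R) :=
    { (inferInstance : CStarAlgebra (UniversalCStar R)) with mul_comm := hcomm }
  have hinj : Function.Injective φ := by
    refine (injective_iff_map_eq_zero φ).2 fun t ht => ?_
    have h : gelfandStarTransform (UniversalCStar R) t = 0 := by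
      ext χ
      let f : UniversalCStar R →⋆ₐ[ℂ] ℂ :=
        { WeakDual.CharacterSpace.toAlgHom χ with
          map_star' := fun s => map_star χ s }
      have hun : ∀ s ∈ unitary (UniversalCStar R), f s ∈ Submonoid.unitSphere ℂ := fun s hs => by
        have h1 := congrArg f (Unitary.star_mul_self_of_mem hs)
        rw [map_mul, map_star, map_one] at h1
        have h2 := CStarRing.norm_star_mul_self (x := f s)
        rw [h1, norm_one] at h2
        refine mem_sphere_zero_iff_norm.2 ?_
        nlinarith [norm_nonneg (f s)]
      let z : Circle × Circle := (⟨f x, hun x hx⟩, ⟨f y, hun y hy⟩)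
      -- A character is determined by its values on the two unitaries, which form a point of the
      -- torus. So every character factors through `φ`, and the Gelfand transform vanishes on the
      -- kernel of `φ`.
      have hf : f = (ContinuousMap.evalStarAlgHom ℂ ℂ z).comp φ :=
        hgen _ _ (hφx z).symm (hφy z).symm
      have : f t = 0 := by
        rw [hf]
        change φ t z = 0
        rw [ht]
        rfl
      exact this
    exact (map_eq_zero_iff _ (gelfandStarTransform (UniversalCStar R)).injective).1 h
  refine ⟨hinj, fun g => ?_⟩
  have hclosed : IsClosed (Set.range φ) :=
    (NonUnitalStarAlgHom.isometry φ hinj).isClosedEmbedding.isClosed_range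
  -- The two coordinates separate points, so the range is dense by Stone–Weierstrass. It is closed
  -- because an injective ⋆-homomorphism is isometric.
  have hsep : (φ.range).SeparatesPoints := by
    intro z w hzw
    by_cases h1 : z.1 = w.1
    · refine ⟨_, ⟨φ y, ⟨y, rfl⟩, rfl⟩, ?_⟩
      change φ y z ≠ φ y w
      rw [hφy, hφy]
      exact fun h2 => hzw (Prod.ext h1 (Subtype.ext h2))
    · refine ⟨_, ⟨φ x, ⟨x, rfl⟩, rfl⟩, ?_⟩
      change φ x z ≠ φ x w
      rw [hφx, hφx]
      exact fun h2 => h1 (Subtype.ext h2)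
  have htop := ContinuousMap.starSubalgebra_topologicalClosure_eq_top_of_separatesPoints _ hsep
  have hg : g ∈ (φ.range).topologicalClosure := htop ▸ StarSubalgebra.mem_top
  have hg' : g ∈ closure (Set.range φ) := hg
  rwa [hclosed.closure_eq] at hg'

/-- If the fundamental corepresentation is diagonal, then the quantum group is the torus. -/
theorem quantumGroupIso_torusMatrix {E : Fin 3 → Fin 3 → Fin 3 → ℂ} (hE : PermutationCondition E)
    (σ : Equiv.Perm (Fin 3))
    (h0 : ∀ j, j ≠ σ 0 → woronowiczMatrix E (σ 0) j = 0 ∧ woronowiczMatrix E j (σ 0) = 0)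
    (h12 : woronowiczMatrix E (σ 1) (σ 2) = 0) (h21 : woronowiczMatrix E (σ 2) (σ 1) = 0) :
    QuantumGroupIso (woronowiczMatrix E) torusMatrix := by
  have hE' : PermutationCondition fun i j k => E (σ i) (σ j) (σ k) := fun i j k => by
    simp only [hE _ _ _, ne_eq, EmbeddingLike.apply_eq_iff_eq]
  obtain ⟨hx, hy, hxy, hv⟩ := ((woronowiczRelations_woronowiczMatrix E).submatrix
    σ).diagonal_entries hE' (fun j hj => h0 (σ j) (σ.injective.ne hj)) h12 h21
  simp only [Matrix.submatrix_apply] at hx hy hxy hv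
  have z1 := h0 (σ 1) (σ.injective.ne (by decide))
  have z2 := h0 (σ 2) (σ.injective.ne (by decide))
  set x := woronowiczMatrix E (σ 1) (σ 1) with hxdef
  set y := woronowiczMatrix E (σ 2) (σ 2) with hydef
  have hu : ∀ i j, woronowiczMatrix E i j = 0 ∨ woronowiczMatrix E i j = x ∨
      woronowiczMatrix E i j = y ∨ woronowiczMatrix E i j = star (x * y) := by
    intro i j
    obtain ⟨i, rfl⟩ := σ.surjective i
    obtain ⟨j, rfl⟩ := σ.surjective j
    fin_cases i <;> fin_cases j <;>
      simp [hv, z1, z2, h12, h21, ← hxdef, ← hydef]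
  have hxx : Commute x (star x) := (Commute.refl x).star_right_of_unitary hx
  have hyy : Commute y (star y) := (Commute.refl y).star_right_of_unitary hy
  have hxy' : Commute x (star y) := hxy.star_right_of_unitary hy
  have hyx' : Commute y (star x) := hxy.symm.star_right_of_unitary hx
  have hcomm : ∀ s t : WoronowiczAlgebra E, s * t = t * s := by
    refine UniversalCStar.commute_of_gen (fun i j => ?_) (fun i j => ?_)
    · change Commute (woronowiczMatrix E i.1 i.2) (woronowiczMatrix E j.1 j.2)
      rcases hu i.1 i.2 with h | h | h | h <;> rcases hu j.1 j.2 with h' | h' | h' | h' <;>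
        rw [h, h'] <;> simp only [star_mul, Commute.zero_left, Commute.zero_right, Commute.refl,
          hxy, hxy.symm, Commute.mul_left, Commute.mul_right, hxx, hxx.symm, hyy, hyy.symm, hxy',
          hyx', hxy'.symm, hyx'.symm]
    · change Commute (woronowiczMatrix E i.1 i.2) (star (woronowiczMatrix E j.1 j.2))
      rcases hu i.1 i.2 with h | h | h | h <;> rcases hu j.1 j.2 with h' | h' | h' | h' <;>
        rw [h, h'] <;> simp only [star_mul, star_star, star_zero, Commute.zero_left,
          Commute.zero_right, Commute.refl,
          hxy, hxy.symm, Commute.mul_left, Commute.mul_right, hxx, hxx.symm, hyy, hyy.symm, hxy',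
          hyx', hxy'.symm, hyx'.symm, hxy.star_star, hxy.symm.star_star]
  have hgen : ∀ {B : Type} [CStarAlgebra B] (f g : WoronowiczAlgebra E →⋆ₐ[ℂ] B),
      f x = g x → f y = g y → f = g := by
    intro B _ f g h1 h2
    refine UniversalCStar.hom_ext fun i => ?_
    change f (woronowiczMatrix E i.1 i.2) = g (woronowiczMatrix E i.1 i.2)
    rcases hu i.1 i.2 with h | h | h | h <;> rw [h]
    · rw [map_zero, map_zero]
    · exact h1
    · exact h2
    · rw [map_star, map_mul, map_star, map_mul, h1, h2]
  let p : C(Circle × Circle, ℂ) := ⟨fun z => (z.1 : ℂ), by fun_prop⟩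
  let r : C(Circle × Circle, ℂ) := ⟨fun z => (z.2 : ℂ), by fun_prop⟩
  have hp : p * star p = 1 := by
    ext z
    simp [p, Complex.mul_conj]
  have hr : r * star r = 1 := by
    ext z
    simp [r, Complex.mul_conj]
  -- The entry at the isolated index is chosen so that the product of the diagonal is one.
  have hrel := (woronowiczRelations_diagonal hE' (d := ![star (p * r), p, r])
    (by
      intro i
      fin_cases i
      · change star (p * r) * star (star (p * r)) = 1
        rw [star_star, star_mul]
        linear_combination hr + r * star r * hp
      · exact hp
      · exact hr)
    (by
      change star (p * r) * p * r = 1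
      rw [star_mul]
      linear_combination hr + r * star r * hp)).submatrix σ.symm
  simp only [Equiv.apply_symm_apply] at hrel
  obtain ⟨φ, hφ⟩ := hrel.exists_hom
  have hφx : φ x = p := by simp [hxdef, hφ]
  have hφy : φ y = r := by simp [hydef, hφ]
  have hbij := bijective_of_commuting_unitaries hcomm hx hy hgen φ (fun z => by rw [hφx]; rfl)
    (fun z => by rw [hφy]; rfl)
  let Φ := StarAlgEquiv.ofBijective φ hbij
  have hΦ : ∀ s, Φ s = φ s := fun s => rfl
  have hΦx : Φ.symm p = x := by rw [← hφx, ← hΦ, StarAlgEquiv.symm_apply_apply]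
  have hΦy : Φ.symm r = y := by rw [← hφy, ← hΦ, StarAlgEquiv.symm_apply_apply]
  obtain ⟨Δ, hΔ⟩ := exists_comultiplication E
  have hsum : ∀ f : Fin 3 → MinTensor (WoronowiczAlgebra E) (WoronowiczAlgebra E),
      ∑ i, f i = f (σ 0) + f (σ 1) + f (σ 2) := fun f => by
    rw [← Equiv.sum_comp σ, Fin.sum_univ_three]
  have hl0 : ∀ s, minTmul (0 : WoronowiczAlgebra E) (s : WoronowiczAlgebra E) = 0 := fun s => by
    rw [minTmul, TensorProduct.zero_tmul, map_zero]
  have hΔx : Δ x = minTmul x x := by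
    rw [hxdef, hΔ, hsum, z1.2, h12, hl0, hl0, zero_add, add_zero]
  have hΔy : Δ y = minTmul y y := by
    rw [hydef, hΔ, hsum, z2.2, h21, hl0, hl0, zero_add, zero_add]
  have hl0' : ∀ s, minTmul (0 : C(Circle × Circle, ℂ)) (s : C(Circle × Circle, ℂ)) = 0 :=
    fun s => by rw [minTmul, TensorProduct.zero_tmul, map_zero]
  have hr0' : ∀ s, minTmul (s : C(Circle × Circle, ℂ)) (0 : C(Circle × Circle, ℂ)) = 0 :=
    fun s => by rw [minTmul, TensorProduct.tmul_zero, map_zero]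
  have ht : torusMatrix = Matrix.diagonal ![p, r] := rfl
  refine QuantumGroupIso.of_starAlgEquiv hΔ Φ fun i j => ?_
  rw [ht]
  fin_cases i <;> fin_cases j <;> simp [hl0', hr0', hΦx, hΦy, hΔx, hΔy, minTensorMap_minTmul]
  · exact congrArg₂ minTmul hφx hφx
  · exact congrArg₂ minTmul hφy hφy

/-! ### A representation of the algebra of `U_q(2)` -/

section WeightedComposition

variable {ι : Type}

/-- Weighted composition operators on `ℓ²`. -/
theorem exists_weightedComposition (w : ι → ℂ) (g : ι → ι) (hw : ∀ j, ‖w j‖ ≤ 1)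
    (hg : ∀ j k, w j ≠ 0 → w k ≠ 0 → g j = g k → j = k) :
    ∃ T : lp (fun _ : ι => ℂ) 2 →L[ℂ] lp (fun _ : ι => ℂ) 2, ∀ x j, T x j = w j * x (g j) := by
  classical
  have h2 : (0 : ℝ) < ENNReal.toReal 2 := by norm_num
  have hsum : ∀ (x : lp (fun _ : ι => ℂ) 2) (s : Finset ι),
      ∑ j ∈ s, ‖w j * x (g j)‖ ^ ENNReal.toReal 2 ≤ ‖x‖ ^ ENNReal.toReal 2 := by
    intro x s
    calc ∑ j ∈ s, ‖w j * x (g j)‖ ^ ENNReal.toReal 2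
        = ∑ j ∈ s with w j ≠ 0, ‖w j * x (g j)‖ ^ ENNReal.toReal 2 := by
          refine (Finset.sum_filter_of_ne (p := fun j => w j ≠ 0) fun j _ hj h0 => hj ?_).symm
          rw [h0, zero_mul, norm_zero, Real.zero_rpow h2.ne']
      _ ≤ ∑ j ∈ s with w j ≠ 0, ‖x (g j)‖ ^ ENNReal.toReal 2 := by
          refine Finset.sum_le_sum fun j _ => Real.rpow_le_rpow (norm_nonneg _) ?_ h2.le
          rw [norm_mul]
          exact mul_le_of_le_one_left (norm_nonneg _) (hw j)
      _ = ∑ i ∈ (s.filter fun j => w j ≠ 0).image g, ‖x i‖ ^ ENNReal.toReal 2 := by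
          refine (Finset.sum_image (f := fun i => ‖x i‖ ^ ENNReal.toReal 2)
            fun j hj k hk => ?_).symm
          exact hg j k (Finset.mem_filter.1 hj).2 (Finset.mem_filter.1 hk).2
      _ ≤ ‖x‖ ^ ENNReal.toReal 2 := lp.sum_rpow_le_norm_rpow h2 x _
  let T : lp (fun _ : ι => ℂ) 2 →ₗ[ℂ] lp (fun _ : ι => ℂ) 2 :=
    { toFun := fun x => ⟨fun j => w j * x (g j), memℓp_gen' (hsum x)⟩
      map_add' := fun x y => by
        ext j
        exact mul_add (w j) (x (g j)) (y (g j))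
      map_smul' := fun c x => by
        ext j
        exact mul_left_comm (w j) c (x (g j)) }
  refine ⟨T.mkContinuous 1 fun x => ?_, fun x j => rfl⟩
  rw [one_mul]
  exact lp.norm_le_of_forall_sum_le h2 (norm_nonneg x) (hsum x)

/-- The hypothesis `h` compares the matrix coefficients of `T` with the conjugate transposed ones of
the candidate adjoint in the standard basis. -/
theorem star_weightedComposition [DecidableEq ι] {w w' : ι → ℂ} {g g' : ι → ι}
    {T : lp (fun _ : ι => ℂ) 2 →L[ℂ] lp (fun _ : ι => ℂ) 2} (hT : ∀ x j, T x j = w j * x (g j))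
    (h : ∀ i j, (if g j = i then w j else 0) = if j = g' i then star (w' i) else 0)
    (x : lp (fun _ : ι => ℂ) 2) (i : ι) : star T x i = w' i * x (g' i) := by
  have h1 : T (lp.single 2 i 1) = star (w' i) • lp.single 2 (g' i) 1 := by
    ext j
    have h2 := h i j
    rw [hT]
    simp only [lp.single_apply, Pi.single_apply, lp.coeFn_smul, Pi.smul_apply, smul_eq_mul,
      mul_ite, mul_one, mul_zero]
    exact h2
  have h2 : ⟪lp.single 2 i (1 : ℂ), star T x⟫_ℂ = ⟪T (lp.single 2 i 1), x⟫_ℂ := by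
    rw [ContinuousLinearMap.star_eq_adjoint, ContinuousLinearMap.adjoint_inner_right]
  rw [h1, inner_smul_left, lp.inner_single_left, lp.inner_single_left] at h2
  simpa using h2

end WeightedComposition

/-- `a` is a weighted shift in the variable of `ℕ`, `c` is the bilateral shift in the variable of
`ℤ` with weight `‖q‖ ^ n`, and `v` is diagonal. The bound on `‖q‖` makes the weights contractive and
the square roots meaningful. -/
theorem exists_uqRelations_of_norm_le_one {q : ℂ} (hq : ‖q‖ ≤ 1) :
    ∃ a c v : lp (fun _ : ℕ × ℤ => ℂ) 2 →L[ℂ] lp (fun _ : ℕ × ℤ => ℂ) 2,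
      UqRelations q a c v ∧ c ≠ 0 := by
  classical
  let t : ℂ := (Complex.arg q : ℂ)
  let s : ℕ → ℝ := fun n => √(1 - ‖q‖ ^ (2 * n))
  -- The phases are dictated by the commutation rules: `‖q‖ L m = q̄ L (m - 1)` gives `a c = q̄ c
  -- a`, and `M (m - 1) = exp (-2it) M m` gives the rule for `c` and `v`.
  let L : ℤ → ℂ := fun m => Complex.exp (-(Complex.I * t * m))
  let M : ℤ → ℂ := fun m => Complex.exp (2 * Complex.I * t * m)
  have hpow : ∀ n, ‖q‖ ^ n ≤ 1 := fun n => pow_le_one₀ (norm_nonneg q) hq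
  have hs : ∀ n, s n * s n = 1 - ‖q‖ ^ (2 * n) := fun n =>
    Real.mul_self_sqrt (sub_nonneg.2 (hpow _))
  -- At `n = 0` the adjoint of `a` reads position `n - 1`, which is again 0 in `ℕ`; the vanishing
  -- weight makes this value harmless.
  have hs0 : s 0 = 0 := by simp [s]
  have hsn : ∀ n, ‖(s n : ℂ)‖ ≤ 1 := fun n => by
    rw [Complex.norm_real, Real.norm_of_nonneg (Real.sqrt_nonneg _), Real.sqrt_le_one]
    linarith [pow_nonneg (norm_nonneg q) (2 * n)]
  have hL : ∀ m, ‖L m‖ = 1 := fun m => by simp [L, t, Complex.norm_exp]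
  have hM : ∀ m, ‖M m‖ = 1 := fun m => by simp [M, t, Complex.norm_exp]
  have hLL : ∀ m, L m * starRingEnd ℂ (L m) = 1 := fun m => by
    rw [Complex.mul_conj', hL]; simp
  have hMM : ∀ m, M m * starRingEnd ℂ (M m) = 1 := fun m => by
    rw [Complex.mul_conj', hM]; simp
  have hL2 : ∀ m, ‖q‖ * L m = q * L (m + 1) := fun m => by
    nth_rw 2 [← Complex.norm_mul_exp_arg_mul_I q]
    simp only [L]
    rw [mul_assoc (‖q‖ : ℂ), ← Complex.exp_add]
    congr 2
    push_cast
    ring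
  have hL1 : ∀ m, ‖q‖ * L m = starRingEnd ℂ q * L (m - 1) := fun m => by
    have h1 : starRingEnd ℂ q = ‖q‖ * Complex.exp (-(Complex.I * t)) := by
      conv_lhs => rw [← Complex.norm_mul_exp_arg_mul_I q]
      simp only [Complex.conj_ofReal, ← Complex.exp_conj, map_mul, Complex.conj_I, mul_neg, t,
        mul_comm]
    rw [h1]
    simp only [L]
    rw [mul_assoc (‖q‖ : ℂ), ← Complex.exp_add]
    congr 2
    push_cast
    ring
  have hM1 : ∀ m, M (m - 1) = Complex.exp (-2 * Complex.I * t) * M m := fun m => by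
    simp only [M]
    rw [← Complex.exp_add]
    congr 1
    push_cast
    ring
  have hss : ∀ n, (s n : ℂ) * s n = 1 - ‖q‖ ^ (2 * n) := fun n => by
    rw [← Complex.ofReal_mul, hs]
    push_cast
    rfl
  clear_value s L M
  obtain ⟨a, ha⟩ := exists_weightedComposition
    (fun i : ℕ × ℤ => (s (i.1 + 1) : ℂ) * L i.2) (fun i => (i.1 + 1, i.2))
    (fun i => by rw [norm_mul, hL, mul_one]; exact hsn _)
    (fun i j _ _ h => by simpa [Prod.ext_iff] using h)
  obtain ⟨c, hc⟩ := exists_weightedComposition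
    (fun i : ℕ × ℤ => ((‖q‖ ^ i.1 : ℝ) : ℂ)) (fun i => (i.1, i.2 - 1))
    (fun i => by
      rw [Complex.norm_real, Real.norm_of_nonneg (pow_nonneg (norm_nonneg q) _)]
      exact hpow _)
    (fun i j _ _ h => by simpa [Prod.ext_iff] using h)
  obtain ⟨v, hv⟩ := exists_weightedComposition
    (fun i : ℕ × ℤ => M i.2) id (fun i => (hM _).le) (fun i j _ _ h => h)
  have ha' := star_weightedComposition (w' := fun i : ℕ × ℤ => (s i.1 : ℂ) * star (L i.2))
    (g' := fun i => (i.1 - 1, i.2)) ha (by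
      rintro ⟨n, m⟩ ⟨n', m'⟩
      rcases n with _ | n
      · simp [hs0]
      · simp only [Prod.mk.injEq, Nat.add_right_cancel_iff, Nat.add_sub_cancel]
        split_ifs with h
        · obtain ⟨rfl, rfl⟩ := h
          simp
        · rfl)
  have hc' := star_weightedComposition (w' := fun i : ℕ × ℤ => ((‖q‖ ^ i.1 : ℝ) : ℂ))
    (g' := fun i => (i.1, i.2 + 1)) hc (by
      rintro ⟨n, m⟩ ⟨n', m'⟩
      simp only [Prod.mk.injEq, sub_eq_iff_eq_add]
      split_ifs with h
      · obtain ⟨rfl, rfl⟩ := h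
        simp
      · rfl)
  have hv' := star_weightedComposition (w' := fun i : ℕ × ℤ => star (M i.2)) (g' := id) hv (by
    rintro ⟨n, m⟩ ⟨n', m'⟩
    simp only [id, Prod.mk.injEq]
    split_ifs with h
    · obtain ⟨rfl, rfl⟩ := h
      simp
    · rfl)
  refine ⟨a, c, v, ⟨?_, ?_, ?_, ?_, ?_, ?_, ?_, ?_, ?_⟩, ?_⟩
  · ext x ⟨n, m⟩
    simp [ha, hc]
    linear_combination (‖q‖ ^ n * s (n + 1) * x (n + 1, m - 1)) * hL1 m
  · ext x ⟨n, m⟩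
    simp [ha, hc, hc']
    linear_combination (‖q‖ ^ n * s (n + 1) * x (n + 1, m + 1)) * hL2 m
  · ext x ⟨n, m⟩
    rcases n with _ | n
    · simp [ha, hc, ha', hc', hs0]
    · simp [ha, hc, ha', hc']
      linear_combination (s (n + 1) * s (n + 1) * x (n + 1, m)) * hLL m + x (n + 1, m) * hss (n + 1)
  · ext x ⟨n, m⟩
    change a (star a x) (n, m) + (‖q‖ : ℂ) ^ 2 * star c (c x) (n, m) = x (n, m)
    simp only [ha, hc, ha', hc', Nat.add_sub_cancel, add_sub_cancel_right, Complex.star_def]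
    push_cast
    linear_combination (s (n + 1) * s (n + 1) * x (n, m)) * hLL m + x (n, m) * hss (n + 1)
  · ext x ⟨n, m⟩
    simp [hc, hc']
  · ext x ⟨n, m⟩
    simp [hv, hv']
    linear_combination x (n, m) * hMM m
  · ext x ⟨n, m⟩
    simp [hv, hv']
    linear_combination x (n, m) * hMM m
  · ext x ⟨n, m⟩
    simp [ha, hv]
    ring
  · ext x ⟨n, m⟩
    rw [smul_apply, lp.coeFn_smul, Pi.smul_apply, smul_eq_mul]
    change c (v x) (n, m) = _ * v (c x) (n, m)
    rw [hc, hv, hv, hc]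
    simp only [id]
    linear_combination (((‖q‖ ^ n : ℝ) : ℂ) * x (n, m - 1)) * hM1 m
  · intro h
    -- At height `n = 0` the weight of `c` is `‖q‖ ^ 0 = 1`, so this basis vector is not
    -- annihilated.
    have h1 := hc (lp.single 2 (0, 0) 1) (0, 1)
    rw [h] at h1
    simp at h1

/-- For `‖q‖ ≥ 1` the representation for `q⁻¹` is composed with the symmetry `UqRelations.inv`. The
new `c` is nonzero because `v` is unitary. -/
theorem exists_uqRelations {q : ℂ} (hq : q ≠ 0) :
    ∃ a c v : lp (fun _ : ℕ × ℤ => ℂ) 2 →L[ℂ] lp (fun _ : ℕ × ℤ => ℂ) 2,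
      UqRelations q a c v ∧ c ≠ 0 := by
  rcases le_total ‖q‖ 1 with h | h
  · exact exists_uqRelations_of_norm_le_one h
  · obtain ⟨a, c, v, hu, hc⟩ := exists_uqRelations_of_norm_le_one (q := q⁻¹)
      (by rw [norm_inv]; exact inv_le_one_of_one_le₀ h)
    refine ⟨_, _, _, inv_inv q ▸ hu.inv (inv_ne_zero hq), fun h0 => hc ?_⟩
    have h1 := (smul_eq_zero.1 (neg_eq_zero.1 h0)).resolve_left (inv_ne_zero hq)
    have h2 := congrArg star h1
    rw [star_mul, star_star, star_star, star_zero] at h2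
    rw [← one_mul c, ← hu.star_v_mul_v, mul_assoc, h2, mul_zero]

/-! ### Slice maps -/

section Slice

variable {A B H K G : Type} [CStarAlgebra A] [CStarAlgebra B]
  [NormedAddCommGroup H] [InnerProductSpace ℂ H] [CompleteSpace H]
  [NormedAddCommGroup K] [InnerProductSpace ℂ K] [CompleteSpace K]
  [NormedAddCommGroup G] [InnerProductSpace ℂ G] [CompleteSpace G]

/-- A representation of the algebraic tensor product that is contained in `π ⊗ ρ` extends to the
minimal tensor product. -/
theorem exists_minTensor_extension (π : A →⋆ₐ[ℂ] (H →L[ℂ] H)) (ρ : B →⋆ₐ[ℂ] (K →L[ℂ] K))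
    (f : A ⊗[ℂ] B →⋆ₐ[ℂ] (G →L[ℂ] G)) (V : G → H ⊗[ℂ] K) (hV : ∀ ξ, ‖V ξ‖ = ‖ξ‖)
    (hf : ∀ t ξ, tensorRep π ρ t (V ξ) = V (f t ξ)) :
    ∃ S : MinTensor A B →⋆ₐ[ℂ] (G →L[ℂ] G), ∀ a b, S (minTmul a b) = f (a ⊗ₜ b) := by
  obtain ⟨S, hS⟩ := CStarSeminorm.exists_extension (p := minSeminorm A B) f fun t => by
    have h1 : ‖f t‖ ≤ ‖tensorRep π ρ t‖ := by
      refine ContinuousLinearMap.opNorm_le_bound _ (ContinuousLinearMap.opNorm_nonneg _) fun ξ => ?_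
      rw [← hV, ← hf, ← hV ξ]
      exact ContinuousLinearMap.le_opNorm _ _
    refine h1.trans (CStarSeminorm.le_sup _ _ (spatialSeminorm π ρ) ?_ t)
    exact ⟨H, K, _, _, inferInstance, _, _, inferInstance, _, _, rfl⟩
  exact ⟨S, fun a b => hS (a ⊗ₜ b)⟩

/-- The one-dimensional representation given by a character. -/
def characterRep (χ : B →⋆ₐ[ℂ] ℂ) : B →⋆ₐ[ℂ] (ℂ →L[ℂ] ℂ) :=
  (StarAlgHom.ofId ℂ (ℂ →L[ℂ] ℂ)).comp χ

theorem characterRep_apply (χ : B →⋆ₐ[ℂ] ℂ) (b : B) (z : ℂ) : characterRep χ b z = χ b * z := rfl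

/-- A character is a one-dimensional representation, and `ξ ↦ ξ ⊗ 1` embeds `H` isometrically into
`H ⊗ ℂ`. Hence the slice is bounded by the minimal norm. -/
theorem exists_slice_right (π : A →⋆ₐ[ℂ] (H →L[ℂ] H)) (χ : B →⋆ₐ[ℂ] ℂ) :
    ∃ S : MinTensor A B →⋆ₐ[ℂ] (H →L[ℂ] H), ∀ a b, S (minTmul a b) = χ b • π a := by
  let f₀ : A ⊗[ℂ] B →ₐ[ℂ] (H →L[ℂ] H) := Algebra.TensorProduct.lift (π : A →ₐ[ℂ] (H →L[ℂ] H))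
    ((Algebra.ofId ℂ (H →L[ℂ] H)).comp (χ : B →ₐ[ℂ] ℂ))
    fun a b => (Algebra.commutes (χ b) (π a)).symm
  have hf₀ : ∀ a b, f₀ (a ⊗ₜ b) = χ b • π a := fun a b =>
    (Algebra.TensorProduct.lift_tmul _ _ _ a b).trans
      ((Algebra.commutes (χ b) (π a)).symm.trans (Algebra.smul_def _ _).symm)
  let f : A ⊗[ℂ] B →⋆ₐ[ℂ] (H →L[ℂ] H) :=
    { f₀ with
      map_star' := fun t => by
        change f₀ (star t) = star (f₀ t)
        induction t with
        | zero => simp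
        | add s t hs ht => rw [star_add, map_add, map_add, star_add, hs, ht]
        | tmul a b => rw [TensorProduct.star_tmul, hf₀, hf₀, star_smul, map_star, map_star] }
  obtain ⟨S, hS⟩ := exists_minTensor_extension π (characterRep χ) f (fun ξ => ξ ⊗ₜ 1)
    (fun ξ => by rw [TensorProduct.norm_tmul, norm_one, mul_one]) (fun t ξ => by
      change _ = f₀ t ξ ⊗ₜ 1
      induction t with
      | zero => simp
      | add s t hs ht => rw [map_add, map_add, add_apply, hs, ht, add_apply, TensorProduct.add_tmul]
      | tmul a b =>
        rw [tensorRep_tmul, characterRep_apply, hf₀, mul_one, smul_apply,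
          TensorProduct.smul_tmul, smul_eq_mul, mul_one])
  exact ⟨S, fun a b => (hS a b).trans (hf₀ a b)⟩

theorem exists_slice_left (χ : A →⋆ₐ[ℂ] ℂ) (π : B →⋆ₐ[ℂ] (H →L[ℂ] H)) :
    ∃ S : MinTensor A B →⋆ₐ[ℂ] (H →L[ℂ] H), ∀ a b, S (minTmul a b) = χ a • π b := by
  let f₀ : A ⊗[ℂ] B →ₐ[ℂ] (H →L[ℂ] H) := Algebra.TensorProduct.lift
    ((Algebra.ofId ℂ (H →L[ℂ] H)).comp (χ : A →ₐ[ℂ] ℂ)) (π : B →ₐ[ℂ] (H →L[ℂ] H))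
    fun a b => Algebra.commutes (χ a) (π b)
  have hf₀ : ∀ a b, f₀ (a ⊗ₜ b) = χ a • π b := fun a b =>
    (Algebra.TensorProduct.lift_tmul _ _ _ a b).trans
      (show algebraMap ℂ (H →L[ℂ] H) (χ a) * π b = χ a • π b from (Algebra.smul_def _ _).symm)
  let f : A ⊗[ℂ] B →⋆ₐ[ℂ] (H →L[ℂ] H) :=
    { f₀ with
      map_star' := fun t => by
        change f₀ (star t) = star (f₀ t)
        induction t with
        | zero => simp
        | add s t hs ht => rw [star_add, map_add, map_add, star_add, hs, ht]
        | tmul a b => rw [TensorProduct.star_tmul, hf₀, hf₀, star_smul, map_star, map_star] }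
  obtain ⟨S, hS⟩ := exists_minTensor_extension (characterRep χ) π f (fun ξ => 1 ⊗ₜ ξ)
    (fun ξ => by rw [TensorProduct.norm_tmul, norm_one, one_mul]) (fun t ξ => by
      change _ = 1 ⊗ₜ f₀ t ξ
      induction t with
      | zero => simp
      | add s t hs ht => rw [map_add, map_add, add_apply, hs, ht, add_apply, TensorProduct.tmul_add]
      | tmul a b =>
        rw [tensorRep_tmul, characterRep_apply, hf₀, mul_one, smul_apply,
          TensorProduct.tmul_smul, TensorProduct.smul_tmul', smul_eq_mul, mul_one])
  exact ⟨S, fun a b => (hS a b).trans (hf₀ a b)⟩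

end Slice

/-! ### Separating the torus from `U_q(2)` -/

/-- A quantum group with a diagonal fundamental corepresentation is not isomorphic to `U_q(2)`. -/
theorem not_quantumGroupIso_uqMatrix_of_diagonal {E : Fin 3 → Fin 3 → Fin 3 → ℂ}
    (hdiag : ∀ i j, i ≠ j → woronowiczMatrix E i j = 0) {q : ℂ} (hq : q ≠ 0) :
    ¬ QuantumGroupIso (woronowiczMatrix E) (uqMatrix q) := by
  rintro ⟨ΔA, ΔB, hA, hB, Φ, hΦ⟩
  obtain ⟨a, c, v, hu, hc⟩ := exists_uqRelations hq
  obtain ⟨π, -, hπc, -⟩ := hu.exists_hom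
  -- The point `diag (-1, 1, -1)` of the diagonal torus. Its two block entries differ, and this is
  -- what makes the two slices of `Δ c` differ.
  have hχ : UqRelations q (1 : ℂ) 0 (-1) := by constructor <;> simp
  obtain ⟨χ, hχa, hχc, hχv⟩ := hχ.exists_hom
  obtain ⟨S, hS⟩ := exists_slice_right π χ
  obtain ⟨T, hT⟩ := exists_slice_left χ π
  let ΦΦ := minTensorMap (Φ : WoronowiczAlgebra E →⋆ₐ[ℂ] UqAlgebra q)
    (Φ : WoronowiczAlgebra E →⋆ₐ[ℂ] UqAlgebra q)
  -- Each diagonal entry is group-like, so both slices send it to the same multiple of its image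
  -- under `π`; the off-diagonal entries vanish.
  have h1 : S.comp (ΦΦ.comp ΔA) = T.comp (ΦΦ.comp ΔA) := by
    refine UniversalCStar.hom_ext fun i => ?_
    change S (ΦΦ (ΔA (woronowiczMatrix E i.1 i.2))) = T (ΦΦ (ΔA (woronowiczMatrix E i.1 i.2)))
    rw [hA, map_sum, map_sum, map_sum]
    refine Finset.sum_congr rfl fun k _ => ?_
    rw [minTensorMap_minTmul, hS, hT]
    by_cases h2 : i.1 = k
    · by_cases h3 : k = i.2
      · rw [h2, ← h3]
      · rw [hdiag k i.2 h3, map_zero, map_zero, map_zero, zero_smul, smul_zero]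
    · rw [hdiag i.1 k h2, map_zero, map_zero, map_zero, zero_smul, smul_zero]
  have h2 : ∀ y, S (ΔB y) = T (ΔB y) := fun y => by
    have h3 := DFunLike.congr_fun h1 (Φ.symm y)
    change S (ΦΦ (ΔA (Φ.symm y))) = T (ΦΦ (ΔA (Φ.symm y))) at h3
    rw [← hΦ, StarAlgEquiv.apply_symm_apply] at h3
    exact h3
  -- `Δ c = c ⊗ a + a⋆ v⋆ ⊗ c`: the right slice gives `π c` and the left slice gives `-π c`.
  have h3 := h2 (uqMatrix q 2 1)
  rw [hB, map_sum, map_sum, Fin.sum_univ_three, Fin.sum_univ_three] at h3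
  simp only [hS, hT] at h3
  simp [uqMatrix, hχa, hχc, hχv, map_star, hπc] at h3
  have h4 : (2 : ℂ) • c = 0 := by
    rw [two_smul]
    nth_rw 1 [h3]
    exact neg_add_cancel c
  exact hc ((smul_eq_zero.1 h4).resolve_left two_ne_zero)

end

/-! ### The dichotomy and its parameter -/

theorem mainTheorem2 (E : Fin 3 → Fin 3 → Fin 3 → ℂ) (hE : PermutationCondition E)
    (k r i : Fin 3) (hkr : k ≠ r) (hki : k ≠ i) (hri : r ≠ i)
    (hblock : ∀ j, j ≠ k → woronowiczMatrix E k j = 0 ∧ woronowiczMatrix E j k = 0) :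
    (QuantumGroupIso (woronowiczMatrix E) torusMatrix ∨
      ∃ q : ℂ, q ≠ 0 ∧ QuantumGroupIso (woronowiczMatrix E) (uqMatrix q)) ∧
    ((∃ q : ℂ, q ≠ 0 ∧ QuantumGroupIso (woronowiczMatrix E) (uqMatrix q)) ↔
      (E k r i / E k i r = E r i k / E i r k ∧
        E k r i / E k i r = star (E r k i) / star (E i k r))) ∧
    ((E k r i / E k i r = E r i k / E i r k ∧
        E k r i / E k i r = star (E r k i) / star (E i k r)) →
      -(E k r i / E k i r) ≠ 0 ∧
        QuantumGroupIso (woronowiczMatrix E) (uqMatrix (-(E k r i / E k i r)))) := by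
  have hinj : ∀ {x y z : Fin 3}, x ≠ y → x ≠ z → y ≠ z → Function.Bijective ![x, y, z] := by
    intro x y z h1 h2 h3
    refine Finite.injective_iff_bijective.1 fun a b hab => ?_
    fin_cases a <;> fin_cases b <;> simp [h1, h2, h3, h1.symm, h2.symm, h3.symm] at hab ⊢
  have n1 : E k r i ≠ 0 := (hE k r i).2 ⟨hkr, hki, hri⟩
  have n2 : E k i r ≠ 0 := (hE k i r).2 ⟨hki, hkr, hri.symm⟩
  have n3 : E r i k ≠ 0 := (hE r i k).2 ⟨hri, hkr.symm, hki.symm⟩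
  have n4 : E i r k ≠ 0 := (hE i r k).2 ⟨hri.symm, hki.symm, hkr.symm⟩
  have n5 : E r k i ≠ 0 := (hE r k i).2 ⟨hkr.symm, hri, hki⟩
  have n6 : E i k r ≠ 0 := (hE i k r).2 ⟨hki.symm, hri.symm, hkr⟩
  have n5' : star (E r k i) ≠ 0 := star_ne_zero.2 n5
  have n6' : star (E i k r) ≠ 0 := star_ne_zero.2 n6
  have pos : (E k r i / E k i r = E r i k / E i r k ∧
        E k r i / E k i r = star (E r k i) / star (E i k r)) →
      -(E k r i / E k i r) ≠ 0 ∧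
        QuantumGroupIso (woronowiczMatrix E) (uqMatrix (-(E k r i / E k i r))) := by
    rintro ⟨h1, h2⟩
    refine ⟨neg_ne_zero.2 (div_ne_zero n1 n2), ?_⟩
    -- The order `k, i, r` makes the normalised parameter `-(E 0 2 1 / E 0 1 2)` equal to `-(E k r i
    -- / E k i r)`; the order `k, r, i` would give its inverse.
    refine quantumGroupIso_uqMatrix hE (Equiv.ofBijective _ (hinj hki hkr hri.symm)) hblock
      (neg_ne_zero.2 (div_ne_zero n1 n2)) ?_ ?_ ?_
    · change E k r i = -(-(E k r i / E k i r) * E k i r)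
      field_simp
    · change E r i k = -(-(E k r i / E k i r) * E i r k)
      rw [h1]
      field_simp
    · change E r k i = -(star (-(E k r i / E k i r)) * E i k r)
      rw [h2, star_neg, star_div₀, star_star, star_star]
      field_simp
  have neg : ¬ (E k r i / E k i r = E r i k / E i r k ∧
        E k r i / E k i r = star (E r k i) / star (E i k r)) →
      woronowiczMatrix E r i = 0 ∧ woronowiczMatrix E i r = 0 := fun hcond => by
    -- With the order `k, r, i` the compatibility conditions of `diagonal_of_not_compatible` are
    -- literally the two given conditions.
    let σ : Equiv.Perm (Fin 3) := Equiv.ofBijective _ (hinj hkr hki hri)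
    have hE' : PermutationCondition fun a b c => E (σ a) (σ b) (σ c) := fun a b c => by
      simp only [hE _ _ _, ne_eq, EmbeddingLike.apply_eq_iff_eq]
    exact ((woronowiczRelations_woronowiczMatrix E).submatrix σ).diagonal_of_not_compatible hE'
      (fun j hj => hblock (σ j) (σ.injective.ne hj)) hcond
  refine ⟨?_, ⟨?_, fun h => ⟨_, pos h⟩⟩, pos⟩
  · by_cases hcond : E k r i / E k i r = E r i k / E i r k ∧
        E k r i / E k i r = star (E r k i) / star (E i k r)
    · exact Or.inr ⟨_, pos hcond⟩
    · exact Or.inl (quantumGroupIso_torusMatrix hE (Equiv.ofBijective _ (hinj hkr hki hri)) hblock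
        (neg hcond).1 (neg hcond).2)
  · rintro ⟨q, hq, hiso⟩
    by_contra hcond
    -- If a condition failed, the whole matrix would be diagonal, which excludes every `U_q(2)` and
    -- not only the expected one.
    refine not_quantumGroupIso_uqMatrix_of_diagonal (fun a b hab => ?_) hq hiso
    obtain ⟨a, rfl⟩ := (hinj hkr hki hri).2 a
    obtain ⟨b, rfl⟩ := (hinj hkr hki hri).2 b
    obtain ⟨h1, h2⟩ := neg hcond
    obtain ⟨h3, h4⟩ := hblock r hkr.symm
    obtain ⟨h5, h6⟩ := hblock i hki.symm
    fin_cases a <;> fin_cases b <;> simp [h1, h2, h3, h4, h5, h6] at hab ⊢
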